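/- **Theorem.** All systems are finite-dimensional and carry a fixed orthonormal *incoherent basis*: $\{|x\rangle\}_{x=0}^{d_A-1}$ for Alice, $\{|y\rangle\}_{y=0}^{d_B-1}$ for Bob, and $\{|x\rangle|y\rangle\}$ for the joint system $AB$; a state is *incoherent* if its density matrix is diagonal in the incoherent basis. Let $S(\omega)=-\mathrm{tr}(\omega\log_2\omega)$ be the von Neumann entropy and $\Delta(\omega)=\sum_{x,y}|xy\rangle\langle xy|\omega|xy\rangle\langle xy|$ the completely dephasing channel. For a pure state $\Psi=|\Psi\rangle\langle\Psi|$ of $AB$ put $$C_{\mathcal L}(\Psi)=S(X)_{\Delta(\Psi)}+S(Y)_{\Delta(\Psi)}-\mathrm E(\Psi),$$ where $S(X)_{\Delta(\Psi)}=S(\mathrm{tr}_B\,\Delta(\Psi))$, $S(Y)_{\Delta(\Psi)}=S(\mathrm{tr}_A\,\Delta(\Psi))$ and $\mathrm E(\Psi)=S(\mathrm{tr}_B\,\Psi)$ is the entropy of entanglement of $\Psi$ itself. For an arbitrary state $\rho$ of $AB$ let $C_{\mathcal L}(\rho)$ be the convex roof $$C_{\mathcal L}(\rho)=\inf\Big\{\sum_k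 p_k\,C_{\mathcal L}(\varphi_k)\;:\;\rho=\sum_k p_k|\varphi_k\rangle\langle\varphi_k|\Big\},$$ the infimum being over all finite ensembles of pure states with average $\rho$. A *local incoherent operation* of Alice is given by a finite set of Kraus operators $K_\alpha$, possibly with output spaces other than the input space, such that $\sum_\alpha K_\alpha^\dagger K_\alpha=\mathbb I$ and such that each $K_\alpha\otimes\mathbb I^B$ maps every incoherent state, after normalization and unless the outcome has probability zero, to an incoherent state; similarly for Bob. An *LIOCC protocol* (local incoherent operations and classical communication) consists of finitely many rounds, in each of which one of the parties performs a local incoherent operation, which may depend on everything announced so far, and announces some of its measurement data (data not announced are discarded, unless they are recorded in the party's own system); at the end some of the announced data may be discarded as well. It transforms $\rho$ into states $\rho_k$ with probabilities $p_k$, where $k$ is the final outcome. Then $C_{\mathcal L}$ is well defined (for every $\rho$ the infimum is over a nonempty set that is bounded below, and on pure states it agrees with the first formula), and it is an LIOCC monotone: it is nonnegative and convex on the states of $AB$, and for every state $\rho$ and every LIOCC protocol $\rho\to\{p_k,\rho_k\}$ $$\sum_k p_k\,C_{\mathcal L}(\rho_k)\le C_{\mathcal L}(\rho);$$ in particular $C_{\mathcal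 L}(\mathcal L(\rho))\le C_{\mathcal L}(\rho)$ for every deterministic LIOCC operation $\mathcal L$. -/

import Mathlib

open scoped Matrix Kronecker ComplexOrder

noncomputable section

namespace LIOCC

/-! Finite-dimensional systems with a fixed incoherent basis: a `d`-dimensional system is `Fin d → ℂ`,
its incoherent basis is the standard basis, and a joint system of Alice (dimension `a`) and Bob
(dimension `b`) is indexed by `Fin a × Fin b`. -/

/-- Density matrices. -/
def IsState {n : Type} [Fintype n] (ρ : Matrix n n ℂ) : Prop :=
  ρ.PosSemidef ∧ ρ.trace = 1

/-- Unit vectors. -/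
def IsUnitVec {n : Type} [Fintype n] (ψ : n → ℂ) : Prop :=
  ∑ i, ‖ψ i‖ ^ 2 = 1

/-- The matrix `|ψ⟩⟨ψ|`. -/
def proj {n : Type} (ψ : n → ℂ) : Matrix n n ℂ :=
  Matrix.vecMulVec ψ (star ψ)

/-- Incoherent states: density matrices that are diagonal in the incoherent basis. -/
def IsIncoherentState {n : Type} [Fintype n] (ρ : Matrix n n ℂ) : Prop :=
  IsState ρ ∧ ρ.IsDiag

/-- The completely dephasing channel `Δ`. -/
def dephase {n : Type} [DecidableEq n] (ρ : Matrix n n ℂ) : Matrix n n ℂ :=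
  Matrix.diagonal ρ.diag

/-- Alice's reduced matrix (trace over Bob). -/
def reduceA {a b : ℕ} (ρ : Matrix (Fin a × Fin b) (Fin a × Fin b) ℂ) : Matrix (Fin a) (Fin a) ℂ :=
  fun x x' => ∑ y, ρ (x, y) (x', y)

/-- Bob's reduced matrix (trace over Alice). -/
def reduceB {a b : ℕ} (ρ : Matrix (Fin a × Fin b) (Fin a × Fin b) ℂ) : Matrix (Fin b) (Fin b) ℂ :=
  fun y y' => ∑ x, ρ (x, y) (x, y')

open Classical in
/-- The von Neumann entropy `-tr (ρ log₂ ρ)` of a Hermitian matrix, from its eigenvalues (with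
multiplicity); the value is `0` on non-Hermitian matrices. -/
def entropy {n : Type} [Fintype n] [DecidableEq n] (ρ : Matrix n n ℂ) : ℝ :=
  if h : ρ.IsHermitian then ∑ i, Real.negMulLog (h.eigenvalues i) / Real.log 2 else 0

/-- The entropy of entanglement of a bipartite pure state. -/
def entanglement {a b : ℕ} (ψ : Fin a × Fin b → ℂ) : ℝ :=
  entropy (reduceA (proj ψ))

/-- `C_L` of a bipartite pure state: `S(X) + S(Y) - E`, where `X` and `Y` are the local systems of
the dephased state. -/
def pureCL {a b : ℕ} (ψ : Fin a × Fin b → ℂ) : ℝ :=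
  entropy (reduceA (dephase (proj ψ))) + entropy (reduceB (dephase (proj ψ))) - entanglement ψ

/-- `p, φ` is a (finite) pure-state ensemble for `ρ`. -/
def IsEnsemble {a b n : ℕ} (ρ : Matrix (Fin a × Fin b) (Fin a × Fin b) ℂ)
    (p : Fin n → ℝ) (φ : Fin n → Fin a × Fin b → ℂ) : Prop :=
  (∀ k, 0 ≤ p k) ∧ ∑ k, p k = 1 ∧ (∀ k, IsUnitVec (φ k)) ∧ ρ = ∑ k, (p k : ℂ) • proj (φ k)

/-- The average values of `pureCL` over the pure-state ensembles for `ρ`. -/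
def ensembleAverages {a b : ℕ} (ρ : Matrix (Fin a × Fin b) (Fin a × Fin b) ℂ) : Set ℝ :=
  {c : ℝ | ∃ (n : ℕ) (p : Fin n → ℝ) (φ : Fin n → Fin a × Fin b → ℂ),
    IsEnsemble ρ p φ ∧ c = ∑ k, p k * pureCL (φ k)}

/-- `C_L` of an arbitrary bipartite state: the convex roof of `pureCL`. -/
def CL {a b : ℕ} (ρ : Matrix (Fin a × Fin b) (Fin a × Fin b) ℂ) : ℝ :=
  sInf (ensembleAverages ρ)

/-- An operator is incoherent if it maps every incoherent state, after normalization, to an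
incoherent state, unless the outcome has probability zero. -/
def IsIncoherentOp {m n : Type} [Fintype m] [Fintype n] (M : Matrix m n ℂ) : Prop :=
  ∀ ρ : Matrix n n ℂ, IsIncoherentState ρ → (M * ρ * Mᴴ).trace ≠ 0 →
    IsIncoherentState ((M * ρ * Mᴴ).trace⁻¹ • (M * ρ * Mᴴ))

/-- A quantum instrument on a `d`-dimensional system, given by a complete finite set of Kraus
operators `kraus i j`. The outcome `i` is announced, `j` is not. The dimension of the system
afterwards may depend on `i`, so that ancillas may be added and subsystems discarded. -/
structure Instrument (d : ℕ) where
  /-- the number of announced outcomes -/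
  num : ℕ
  /-- the number of Kraus operators of an announced outcome -/
  mult : Fin num → ℕ
  /-- the dimension of the system after an announced outcome -/
  out : Fin num → ℕ
  /-- the Kraus operators -/
  kraus : (i : Fin num) → Fin (mult i) → Matrix (Fin (out i)) (Fin d) ℂ
  complete : ∑ i, ∑ j, (kraus i j)ᴴ * kraus i j = 1

/-- LIOCC protocols on an `a ⊗ b` system with `n` final outcomes, the final outcome `k` leaving a
system `dA k ⊗ dB k`. In each round one of the parties performs a local incoherent operation,
announces its outcome, and the rest of the protocol may depend on it. At the end of each branch a
final outcome is declared; different branches may declare the same one, in which case the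
information that tells them apart is discarded. -/
inductive Protocol {n : ℕ} (dA dB : Fin n → ℕ) : ℕ → ℕ → Type
  | done (k : Fin n) : Protocol dA dB (dA k) (dB k)
  | alice {a b : ℕ} (I : Instrument a)
      (hI : ∀ i j, IsIncoherentOp (I.kraus i j ⊗ₖ (1 : Matrix (Fin b) (Fin b) ℂ)))
      (next : ∀ i, Protocol dA dB (I.out i) b) : Protocol dA dB a b
  | bob {a b : ℕ} (I : Instrument b)
      (hI : ∀ i j, IsIncoherentOp ((1 : Matrix (Fin a) (Fin a) ℂ) ⊗ₖ I.kraus i j))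
      (next : ∀ i, Protocol dA dB a (I.out i)) : Protocol dA dB a b

/-- The unnormalized final state for each final outcome; its trace is the probability of that
outcome. -/
def Protocol.run {n : ℕ} {dA dB : Fin n → ℕ} : {a b : ℕ} → Protocol dA dB a b →
    Matrix (Fin a × Fin b) (Fin a × Fin b) ℂ →
    (k : Fin n) → Matrix (Fin (dA k) × Fin (dB k)) (Fin (dA k) × Fin (dB k)) ℂ
  | _, _, .done k₀, ρ => Function.update (fun _ => 0) k₀ ρ
  | _, b, .alice I _ next, ρ => fun k =>
      ∑ i, (next i).run (∑ j, (I.kraus i j ⊗ₖ (1 : Matrix (Fin b) (Fin b) ℂ)) * ρ *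
        (I.kraus i j ⊗ₖ (1 : Matrix (Fin b) (Fin b) ℂ))ᴴ) k
  | a, _, .bob I _ next, ρ => fun k =>
      ∑ i, (next i).run (∑ j, ((1 : Matrix (Fin a) (Fin a) ℂ) ⊗ₖ I.kraus i j) * ρ *
        ((1 : Matrix (Fin a) (Fin a) ℂ) ⊗ₖ I.kraus i j)ᴴ) k

/-- The probability of the final outcome `k`. -/
def Protocol.prob {n : ℕ} {dA dB : Fin n → ℕ} {a b : ℕ} (P : Protocol dA dB a b)
    (ρ : Matrix (Fin a × Fin b) (Fin a × Fin b) ℂ) (k : Fin n) : ℝ :=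
  (P.run ρ k).trace.re

/-- The normalized state after the final outcome `k` (meaningful if its probability is nonzero). -/
def Protocol.post {n : ℕ} {dA dB : Fin n → ℕ} {a b : ℕ} (P : Protocol dA dB a b)
    (ρ : Matrix (Fin a × Fin b) (Fin a × Fin b) ℂ) (k : Fin n) :
    Matrix (Fin (dA k) × Fin (dB k)) (Fin (dA k) × Fin (dB k)) ℂ :=
  ((P.prob ρ k)⁻¹ : ℂ) • P.run ρ k

/-- A function of bipartite states (of all finite dimensions) is an LIOCC monotone if it is
nonnegative, convex, and does not increase under LIOCC protocols, neither deterministically nor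
on average over the final outcomes. -/
structure IsMonotone
    (f : ∀ {a b : ℕ}, Matrix (Fin a × Fin b) (Fin a × Fin b) ℂ → ℝ) : Prop where
  nonneg : ∀ {a b : ℕ} (ρ : Matrix (Fin a × Fin b) (Fin a × Fin b) ℂ), IsState ρ → 0 ≤ f ρ
  convex : ∀ {a b : ℕ} (ρ σ : Matrix (Fin a × Fin b) (Fin a × Fin b) ℂ) (t : ℝ),
    IsState ρ → IsState σ → 0 ≤ t → t ≤ 1 →
    f ((t : ℂ) • ρ + ((1 - t : ℝ) : ℂ) • σ) ≤ t * f ρ + (1 - t) * f σ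
  average : ∀ {a b n : ℕ} {dA dB : Fin n → ℕ} (P : Protocol dA dB a b)
    (ρ : Matrix (Fin a × Fin b) (Fin a × Fin b) ℂ), IsState ρ →
    ∑ k, P.prob ρ k * f (P.post ρ k) ≤ f ρ
  deterministic : ∀ {a b a' b' : ℕ}
    (P : Protocol (fun _ : Fin 1 => a') (fun _ : Fin 1 => b') a b)
    (ρ : Matrix (Fin a × Fin b) (Fin a × Fin b) ℂ), IsState ρ → f (P.run ρ 0) ≤ f ρ

end LIOCC

end

noncomputable section

namespace LIOCC

section Entropy

variable {n : Type} [Fintype n] [DecidableEq n]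

lemma entropy_eq_sum_roots {M : Matrix n n ℂ} (h : M.IsHermitian) :
    entropy M = (M.charpoly.roots.map fun z => Real.negMulLog z.re / Real.log 2).sum := by
  rw [entropy, dif_pos h, h.roots_charpoly_eq_eigenvalues, Multiset.map_map]
  simp

lemma isHermitian_conj_diagonal (U : Matrix n n ℂ) (d : n → ℝ) :
    (U * Matrix.diagonal (fun i => (d i : ℂ)) * Uᴴ).IsHermitian := by
  apply Matrix.isHermitian_mul_mul_conjTranspose
  rw [Matrix.isHermitian_diagonal_iff]
  intro i
  simp [IsSelfAdjoint]

lemma entropy_conj_diagonal {U : Matrix n n ℂ} (hU : Uᴴ * U = 1) (d : n → ℝ) :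
    entropy (U * Matrix.diagonal (fun i => (d i : ℂ)) * Uᴴ) =
      (∑ i, Real.negMulLog (d i)) / Real.log 2 := by
  rw [entropy_eq_sum_roots (isHermitian_conj_diagonal U d), Matrix.mul_assoc,
    Matrix.charpoly_mul_comm, Matrix.mul_assoc, hU, Matrix.mul_one, Matrix.charpoly_diagonal,
    Finset.sum_div]
  have h := Polynomial.roots_multiset_prod_X_sub_C
    (Finset.univ.val.map fun i : n => (d i : ℂ))
  rw [Multiset.map_map] at h
  have h' : (∏ i, (Polynomial.X - Polynomial.C (d i : ℂ))).roots =
      Finset.univ.val.map fun i : n => (d i : ℂ) := h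
  simp [h']

lemma entropy_diagonal (d : n → ℝ) :
    entropy (Matrix.diagonal (fun i => (d i : ℂ))) =
      (∑ i, Real.negMulLog (d i)) / Real.log 2 := by
  simpa using entropy_conj_diagonal (U := (1 : Matrix n n ℂ)) (by simp) d

lemma exists_spectral {ρ : Matrix n n ℂ} (h : ρ.PosSemidef) :
    ∃ (U : Matrix n n ℂ) (l : n → ℝ), Uᴴ * U = 1 ∧ U * Uᴴ = 1 ∧ (∀ i, 0 ≤ l i) ∧
      ρ = U * Matrix.diagonal (fun i => (l i : ℂ)) * Uᴴ := by
  refine ⟨h.1.eigenvectorUnitary, h.1.eigenvalues, ?_, ?_, h.eigenvalues_nonneg, ?_⟩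
  · exact Unitary.coe_star_mul_self _
  · exact Unitary.coe_mul_star_self _
  · exact h.1.spectral_theorem

lemma entropy_mul_conjTranspose_comm {m : Type} [Fintype m] [DecidableEq m] (M : Matrix m n ℂ) :
    entropy (M * Mᴴ) = entropy (Mᴴ * M) := by
  rw [entropy_eq_sum_roots (Matrix.isHermitian_mul_conjTranspose_self M),
    entropy_eq_sum_roots (Matrix.isHermitian_conjTranspose_mul_self M)]
  have h := congrArg (fun p : Polynomial ℂ =>
    (p.roots.map fun z => Real.negMulLog z.re / Real.log 2).sum)
    (Matrix.charpoly_mul_comm' M Mᴴ)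
  rw [Polynomial.roots_mul (mul_ne_zero (pow_ne_zero _ Polynomial.X_ne_zero)
      (Matrix.charpoly_monic _).ne_zero),
    Polynomial.roots_mul (mul_ne_zero (pow_ne_zero _ Polynomial.X_ne_zero)
      (Matrix.charpoly_monic _).ne_zero)] at h
  simpa [Multiset.map_nsmul, Multiset.sum_nsmul] using h

lemma entropy_transpose {M : Matrix n n ℂ} (h : M.IsHermitian) : entropy Mᵀ = entropy M := by
  rw [entropy_eq_sum_roots h, entropy_eq_sum_roots h.transpose, Matrix.charpoly_transpose]

lemma entropy_smul {M : Matrix n n ℂ} (h : M.PosSemidef) (r : ℝ) :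
    entropy ((r : ℂ) • M) =
      r * entropy M + M.trace.re * (Real.negMulLog r / Real.log 2) := by
  obtain ⟨U, l, hU, hU', hl, rfl⟩ := exists_spectral h
  have h1 : (r : ℂ) • (U * Matrix.diagonal (fun i => (l i : ℂ)) * Uᴴ) =
      U * Matrix.diagonal (fun i => ((r * l i : ℝ) : ℂ)) * Uᴴ := by
    rw [← Matrix.smul_mul, ← Matrix.mul_smul, ← Matrix.diagonal_smul]
    simp [Pi.smul_def]
  rw [h1, entropy_conj_diagonal hU, entropy_conj_diagonal hU, Matrix.mul_assoc,
    Matrix.trace_mul_comm, Matrix.mul_assoc, hU, Matrix.mul_one, Matrix.trace_diagonal]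
  simp only [Real.negMulLog_mul, Finset.sum_add_distrib, ← Finset.mul_sum, ← Finset.sum_mul,
    Complex.re_sum, Complex.ofReal_re]
  ring

end Entropy

section Scalar

lemma sub_le_mul_log_sub_log {x y : ℝ} (hx : 0 ≤ x) (hy : 0 ≤ y) (h : y = 0 → x = 0) :
    x - y ≤ x * (Real.log x - Real.log y) := by
  rcases hy.eq_or_lt with rfl | hy
  · simp [h rfl]
  rcases hx.eq_or_lt with rfl | hx
  · simpa using hy.le
  have := Real.self_sub_one_le_mul_log (x := x / y) (by positivity)
  rw [Real.log_div hx.ne' hy.ne'] at this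
  have h2 := mul_le_mul_of_nonneg_left this hy.le
  have h3 : y * (x / y) = x := by field_simp
  calc x - y = y * (x / y - 1) := by rw [mul_sub, h3]; ring
    _ ≤ _ := h2
    _ = _ := by rw [← mul_assoc, h3]

open Filter Topology in
/-- If the resolvent differences `∑ wλ² / (μ + tλ)` are nonnegative for all `t > 0`, then so is
the difference of relative entropies obtained by integrating them over `t`. -/
lemma sum_mul_log_sub_log_nonneg {ι : Type*} [Fintype ι] (w l μ : ι → ℝ)
    (hl : ∀ i, 0 ≤ l i) (hμ : ∀ i, 0 ≤ μ i) (hs : ∀ i, μ i = 0 → w i * l i = 0)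
    (htot : ∑ i, w i * l i = 0)
    (hq : ∀ t : ℝ, 0 < t → 0 ≤ ∑ i, w i * l i ^ 2 / (μ i + t * l i)) :
    0 ≤ ∑ i, w i * l i * (Real.log (l i) - Real.log (μ i)) := by
  set G : ℝ → ℝ := fun t => ∑ i, w i * l i * Real.log (μ i + t * l i) with hG
  have hder : ∀ t : ℝ, 0 < t → HasDerivAt G (∑ i, w i * l i ^ 2 / (μ i + t * l i)) t := by
    intro t ht
    refine HasDerivAt.fun_sum fun i _ => ?_
    rcases (hl i).eq_or_lt with h | h
    · simp only [← h]
      simpa using hasDerivAt_const t (0 : ℝ)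
    · have hp : μ i + t * l i ≠ 0 := (add_pos_of_nonneg_of_pos (hμ i) (mul_pos ht h)).ne'
      have h1 : HasDerivAt (fun t : ℝ => μ i + t * l i) (l i) t := by
        simpa using ((hasDerivAt_id t).mul_const (l i)).const_add (μ i)
      have h2 : w i * l i ^ 2 / (μ i + t * l i) = w i * l i * (l i / (μ i + t * l i)) := by ring
      rw [h2]
      exact (h1.log hp).const_mul (w i * l i)
  have hmono : MonotoneOn G (Set.Ioi 0) := by
    refine monotoneOn_of_deriv_nonneg (convex_Ioi 0)
      (fun t ht => (hder t ht).continuousAt.continuousWithinAt) ?_ ?_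
    · rw [interior_Ioi]
      exact fun t ht => (hder t ht).differentiableAt.differentiableWithinAt
    · rw [interior_Ioi]
      intro t ht
      rw [(hder t ht).deriv]
      exact hq t ht
  have hzero : Tendsto G (𝓝[>] 0) (𝓝 (∑ i, w i * l i * Real.log (μ i))) := by
    refine tendsto_finsetSum _ fun i _ => ?_
    by_cases h : μ i = 0
    · simp [hs i h]
    · refine Tendsto.mono_left ?_ nhdsWithin_le_nhds
      refine Tendsto.const_mul _ ?_
      have h1 : Tendsto (fun t : ℝ => μ i + t * l i) (𝓝 0) (𝓝 (μ i)) := by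
        have : Continuous (fun t : ℝ => μ i + t * l i) := by fun_prop
        simpa using this.tendsto 0
      exact h1.log h
  have hinf : Tendsto G atTop (𝓝 (∑ i, w i * l i * Real.log (l i))) := by
    have h1 : Tendsto (fun t : ℝ => ∑ i, w i * l i * Real.log (μ i * t⁻¹ + l i)) atTop
        (𝓝 (∑ i, w i * l i * Real.log (l i))) := by
      refine tendsto_finsetSum _ fun i _ => ?_
      by_cases h : l i = 0
      · simp [h]
      · refine Tendsto.const_mul _ (Tendsto.log ?_ h)
        simpa using (tendsto_inv_atTop_zero.const_mul (μ i)).add_const (l i)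
    refine h1.congr' ?_
    filter_upwards [eventually_gt_atTop 0] with t ht
    have h2 : ∀ i, w i * l i * Real.log (μ i * t⁻¹ + l i) =
        w i * l i * Real.log (μ i + t * l i) - w i * l i * Real.log t := by
      intro i
      rcases (hl i).eq_or_lt with h | h
      · simp [← h]
      · have hp : μ i + t * l i ≠ 0 := (add_pos_of_nonneg_of_pos (hμ i) (mul_pos ht h)).ne'
        rw [← mul_sub, ← Real.log_div hp ht.ne']
        congr 2
        field_simp
    simp only [h2, Finset.sum_sub_distrib, ← Finset.sum_mul, htot, hG]
    simp
  have hle : ∀ s : ℝ, 0 < s → G s ≤ ∑ i, w i * l i * Real.log (l i) := by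
    intro s hs
    refine ge_of_tendsto hinf ?_
    filter_upwards [eventually_ge_atTop s] with t ht
    exact hmono hs (hs.trans_le ht) ht
  have := le_of_tendsto hzero (eventually_nhdsWithin_of_forall hle)
  simp only [mul_sub, Finset.sum_sub_distrib]
  linarith

/-- Superadditivity of the unnormalized Shannon conditional entropy. -/
lemma sum_negMulLog_sub_le {α β : Type*} [Fintype α] [Fintype β] (q : α → β → ℝ)
    (hq : ∀ a y, 0 ≤ q a y) :
    ∑ a, (∑ y, Real.negMulLog (q a y) - Real.negMulLog (∑ y, q a y)) ≤
      ∑ y, Real.negMulLog (∑ a, q a y) - Real.negMulLog (∑ y, ∑ a, q a y) := by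
  set r : α → ℝ := fun a => ∑ y, q a y with hr
  set c : β → ℝ := fun y => ∑ a, q a y with hc
  set T : ℝ := ∑ y, c y with hT
  have hrT : ∑ a, r a = T := Finset.sum_comm
  have hr0 : ∀ a, 0 ≤ r a := fun a => Finset.sum_nonneg fun y _ => hq a y
  have hc0 : ∀ y, 0 ≤ c y := fun y => Finset.sum_nonneg fun a _ => hq a y
  have hT0 : 0 ≤ T := Finset.sum_nonneg fun y _ => hc0 y
  have hqr : ∀ a y, r a = 0 → q a y = 0 := fun a y h =>
    (Finset.sum_eq_zero_iff_of_nonneg fun y _ => hq a y).1 h y (Finset.mem_univ _)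
  have hqc : ∀ a y, c y = 0 → q a y = 0 := fun a y h =>
    (Finset.sum_eq_zero_iff_of_nonneg fun a _ => hq a y).1 h a (Finset.mem_univ _)
  have hcT : ∀ y, T = 0 → c y = 0 := fun y h =>
    (Finset.sum_eq_zero_iff_of_nonneg fun y _ => hc0 y).1 h y (Finset.mem_univ _)
  have key : ∀ a y, q a y - r a * c y / T ≤ q a y *
      (Real.log (q a y) - (Real.log (r a) + Real.log (c y) - Real.log T)) := by
    intro a y
    by_cases h0 : q a y = 0
    · rw [h0]
      simpa using div_nonneg (mul_nonneg (hr0 a) (hc0 y)) hT0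
    have h1 : r a ≠ 0 := fun h => h0 (hqr a y h)
    have h2 : c y ≠ 0 := fun h => h0 (hqc a y h)
    have h3 : T ≠ 0 := fun h => h2 (hcT y h)
    rw [← Real.log_mul h1 h2, ← Real.log_div (mul_ne_zero h1 h2) h3]
    refine sub_le_mul_log_sub_log (hq a y) (div_nonneg (mul_nonneg (hr0 a) (hc0 y)) hT0) ?_
    intro h
    exact absurd h (div_ne_zero (mul_ne_zero h1 h2) h3)
  have hsum := Finset.sum_le_sum fun a (_ : a ∈ Finset.univ) =>
    Finset.sum_le_sum fun y (_ : y ∈ Finset.univ) => key a y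
  have hlhs : ∑ a, ∑ y, (q a y - r a * c y / T) = 0 := by
    simp only [Finset.sum_sub_distrib, ← Finset.sum_div, ← Finset.mul_sum, ← Finset.sum_mul]
    rw [hrT]
    by_cases h : T = 0
    · simp [h]
    · change T - T * T / T = 0
      field_simp
      simp
  have hrhs : ∑ a, ∑ y, q a y *
      (Real.log (q a y) - (Real.log (r a) + Real.log (c y) - Real.log T)) =
      -(∑ a, (∑ y, Real.negMulLog (q a y) - Real.negMulLog (r a))) +
        (∑ y, Real.negMulLog (c y) - Real.negMulLog T) := by
    have e1 : ∑ a, ∑ y, q a y * Real.log (r a) = ∑ a, r a * Real.log (r a) := by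
      simp only [← Finset.sum_mul, hr]
    have e2 : ∑ a, ∑ y, q a y * Real.log (c y) = ∑ y, c y * Real.log (c y) := by
      rw [Finset.sum_comm]
      simp only [← Finset.sum_mul, hc]
    have e3 : ∑ a, ∑ y, q a y * Real.log T = T * Real.log T := by
      simp only [← Finset.sum_mul]
      rw [show ∑ a, ∑ y, q a y = T from hrT]
    simp only [mul_sub, mul_add, Finset.sum_sub_distrib, Finset.sum_add_distrib, e1, e2, e3,
      Real.negMulLog_eq_neg, Finset.sum_neg_distrib]
    ring
  linarith

end Scalar

section DataProcessing

variable {n : Type} [Fintype n] [DecidableEq n]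

/-- The concave quadratic form in `Z` whose maximum is the resolvent term in the integral
representation of the relative entropy of `ρ` and `σ`. -/
def resolventForm (t : ℝ) (ρ σ Z : Matrix n n ℂ) : ℝ :=
  2 * (Zᴴ * ρ).trace.re - (Zᴴ * σ * Z).trace.re - t * (Z * ρ * Zᴴ).trace.re

lemma re_star_mul_mul_self (z : ℂ) (r : ℝ) : (star z * r * z).re = r * ‖z‖ ^ 2 := by
  rw [← Complex.normSq_eq_norm_sq, Complex.normSq_apply]
  simp
  ring

lemma resolventForm_spectral (t : ℝ) {U : Matrix n n ℂ} (hU : Uᴴ * U = 1) (l μ : n → ℝ)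
    (M : Matrix n n ℂ) :
    resolventForm t (U * Matrix.diagonal (fun i => (l i : ℂ)) * Uᴴ)
      (Matrix.diagonal (fun i => (μ i : ℂ))) (M * Uᴴ) =
    ∑ i, ∑ j, (2 * (star (M j i) * U j i).re * l i - (μ j + t * l i) * ‖M j i‖ ^ 2) := by
  have h1 : ((M * Uᴴ)ᴴ * (U * Matrix.diagonal (fun i => (l i : ℂ)) * Uᴴ)).trace.re =
      ∑ i, ∑ j, (star (M j i) * U j i).re * l i := by
    have : (M * Uᴴ)ᴴ * (U * Matrix.diagonal (fun i => (l i : ℂ)) * Uᴴ) =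
        U * (Mᴴ * U * Matrix.diagonal (fun i => (l i : ℂ)) * Uᴴ) := by
      simp only [Matrix.conjTranspose_mul, Matrix.conjTranspose_conjTranspose, Matrix.mul_assoc]
    rw [this, Matrix.trace_mul_comm, Matrix.mul_assoc _ Uᴴ, hU, Matrix.mul_one]
    simp only [Matrix.trace, Matrix.diag_apply, Matrix.mul_diagonal, Matrix.mul_apply (N := U),
      Matrix.conjTranspose_apply, Complex.re_sum, Complex.re_mul_ofReal, Finset.sum_mul]
  have h2 : ((M * Uᴴ)ᴴ * Matrix.diagonal (fun i => (μ i : ℂ)) * (M * Uᴴ)).trace.re =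
      ∑ i, ∑ j, μ j * ‖M j i‖ ^ 2 := by
    have : (M * Uᴴ)ᴴ * Matrix.diagonal (fun i => (μ i : ℂ)) * (M * Uᴴ) =
        U * (Mᴴ * Matrix.diagonal (fun i => (μ i : ℂ)) * M * Uᴴ) := by
      simp only [Matrix.conjTranspose_mul, Matrix.conjTranspose_conjTranspose, Matrix.mul_assoc]
    rw [this, Matrix.trace_mul_comm, Matrix.mul_assoc _ Uᴴ, hU, Matrix.mul_one]
    simp only [Matrix.trace, Matrix.diag_apply, Matrix.mul_apply (N := M), Matrix.mul_diagonal,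
      Matrix.conjTranspose_apply, Complex.re_sum, re_star_mul_mul_self]
  have h3 : ((M * Uᴴ) * (U * Matrix.diagonal (fun i => (l i : ℂ)) * Uᴴ) * (M * Uᴴ)ᴴ).trace.re =
      ∑ i, ∑ j, l i * ‖M j i‖ ^ 2 := by
    have : (M * Uᴴ) * (U * Matrix.diagonal (fun i => (l i : ℂ)) * Uᴴ) * (M * Uᴴ)ᴴ =
        M * (Uᴴ * U) * Matrix.diagonal (fun i => (l i : ℂ)) * (Uᴴ * U) * Mᴴ := by
      simp only [Matrix.conjTranspose_mul, Matrix.conjTranspose_conjTranspose, Matrix.mul_assoc]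
    rw [this, hU, Matrix.mul_one, Matrix.mul_one]
    simp only [Matrix.trace, Matrix.diag_apply, Matrix.mul_apply (N := Mᴴ), Matrix.mul_diagonal,
      Matrix.conjTranspose_apply, Complex.re_sum]
    rw [Finset.sum_comm]
    refine Finset.sum_congr rfl fun i _ => Finset.sum_congr rfl fun j _ => ?_
    rw [← re_star_mul_mul_self]
    congr 1
    ring
  rw [resolventForm, h1, h2, h3]
  simp only [Finset.mul_sum, ← Finset.sum_sub_distrib]
  refine Finset.sum_congr rfl fun i _ => Finset.sum_congr rfl fun j _ => ?_
  ring

lemma two_mul_re_sub_le (m u : ℂ) {l s : ℝ} (hl : 0 ≤ l) (hs : 0 ≤ s) (h : s = 0 → l = 0) :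
    2 * (star m * u).re * l - s * ‖m‖ ^ 2 ≤ ‖u‖ ^ 2 * l ^ 2 / s := by
  rcases hs.eq_or_lt with rfl | hs
  · simp [h rfl]
  have h1 : (star m * u).re ≤ ‖m‖ * ‖u‖ := by
    simpa using Complex.re_le_norm (star m * u)
  rw [le_div_iff₀ hs]
  nlinarith [sq_nonneg (s * ‖m‖ - ‖u‖ * l), mul_le_mul_of_nonneg_right h1 (mul_nonneg hl hs.le)]

lemma resolventForm_le (t : ℝ) (ht : 0 < t) {U : Matrix n n ℂ} (hU : Uᴴ * U = 1) (l μ : n → ℝ)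
    (hl : ∀ i, 0 ≤ l i) (hμ : ∀ i, 0 ≤ μ i) (Z : Matrix n n ℂ) :
    resolventForm t (U * Matrix.diagonal (fun i => (l i : ℂ)) * Uᴴ)
      (Matrix.diagonal (fun i => (μ i : ℂ))) Z ≤
    ∑ i, ∑ j, ‖U j i‖ ^ 2 * l i ^ 2 / (μ j + t * l i) := by
  have hZ : Z = (Z * U) * Uᴴ := by
    rw [Matrix.mul_assoc, mul_eq_one_comm.1 hU, Matrix.mul_one]
  rw [hZ, resolventForm_spectral t hU]
  refine Finset.sum_le_sum fun i _ => Finset.sum_le_sum fun j _ => ?_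
  have hp := mul_nonneg ht.le (hl i)
  refine two_mul_re_sub_le _ _ (hl i) (add_nonneg (hμ j) hp) fun h => ?_
  have : t * l i = 0 := by linarith [hμ j]
  exact (mul_eq_zero.1 this).resolve_left ht.ne'

lemma exists_resolventForm_eq (t : ℝ) {U : Matrix n n ℂ} (hU : Uᴴ * U = 1) (l μ : n → ℝ) :
    ∃ Z, resolventForm t (U * Matrix.diagonal (fun i => (l i : ℂ)) * Uᴴ)
      (Matrix.diagonal (fun i => (μ i : ℂ))) Z =
    ∑ i, ∑ j, ‖U j i‖ ^ 2 * l i ^ 2 / (μ j + t * l i) := by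
  refine ⟨(Matrix.of fun j i => ((l i / (μ j + t * l i) : ℝ) : ℂ) * U j i) * Uᴴ, ?_⟩
  rw [resolventForm_spectral t hU]
  refine Finset.sum_congr rfl fun i _ => Finset.sum_congr rfl fun j _ => ?_
  rw [Matrix.of_apply]
  generalize μ j + t * l i = s
  have h1 : (star (((l i / s : ℝ) : ℂ) * U j i) * U j i).re = l i / s * ‖U j i‖ ^ 2 := by
    rw [← re_star_mul_mul_self, star_mul]
    simp
  rw [h1, norm_mul, Complex.norm_real, mul_pow, Real.norm_eq_abs, sq_abs]
  by_cases hs : s = 0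
  · simp [hs]
  · field_simp
    ring

variable {κ : Type} [Fintype κ] {m : κ → Type} [∀ α, Fintype (m α)]

/-- The Kadison–Schwarz inequality for the unital map `Y ↦ ∑ Kᴴ Y K`, in weak form. -/
lemma trace_kadison_schwarz (K : ∀ α, Matrix (m α) n ℂ) (hK : ∑ α, (K α)ᴴ * K α = 1)
    {τ : Matrix n n ℂ} (hτ : τ.PosSemidef) (Y : ∀ α, Matrix (m α) (m α) ℂ) :
    ((∑ α, (K α)ᴴ * Y α * K α)ᴴ * τ * (∑ α, (K α)ᴴ * Y α * K α)).trace.re ≤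
      ∑ α, ((Y α)ᴴ * (K α * τ * (K α)ᴴ) * Y α).trace.re := by
  set S := ∑ α, (K α)ᴴ * Y α * K α with hS
  have hSH : Sᴴ = ∑ α, (K α)ᴴ * (Y α)ᴴ * K α := by
    rw [hS, Matrix.conjTranspose_sum]
    refine Finset.sum_congr rfl fun α _ => ?_
    simp only [Matrix.conjTranspose_mul, Matrix.conjTranspose_conjTranspose, Matrix.mul_assoc]
  have hpos : 0 ≤ ∑ α, (((Y α)ᴴ * K α - K α * Sᴴ) * τ * ((Y α)ᴴ * K α - K α * Sᴴ)ᴴ).trace :=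
    Finset.sum_nonneg fun α _ => (hτ.mul_mul_conjTranspose_same _).trace_nonneg
  have hexp : ∑ α, (((Y α)ᴴ * K α - K α * Sᴴ) * τ * ((Y α)ᴴ * K α - K α * Sᴴ)ᴴ).trace =
      ∑ α, ((Y α)ᴴ * (K α * τ * (K α)ᴴ) * Y α).trace - (Sᴴ * τ * S).trace := by
    have h1 : ∀ α, (((Y α)ᴴ * K α - K α * Sᴴ) * τ * ((Y α)ᴴ * K α - K α * Sᴴ)ᴴ).trace =
        ((Y α)ᴴ * (K α * τ * (K α)ᴴ) * Y α).trace
          - (((K α)ᴴ * (Y α)ᴴ * K α) * (τ * S)).trace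
          - ((Sᴴ * τ) * ((K α)ᴴ * Y α * K α)).trace
          + (((K α)ᴴ * K α) * (Sᴴ * τ * S)).trace := by
      intro α
      have e2 : (((K α)ᴴ * (Y α)ᴴ * K α) * (τ * S)).trace =
          ((Y α)ᴴ * K α * τ * S * (K α)ᴴ).trace := by
        simp only [Matrix.mul_assoc]
        rw [Matrix.trace_mul_comm]
        simp only [Matrix.mul_assoc]
      have e3 : ((Sᴴ * τ) * ((K α)ᴴ * Y α * K α)).trace =
          (K α * Sᴴ * τ * (K α)ᴴ * Y α).trace := by
        rw [← Matrix.mul_assoc, Matrix.trace_mul_comm]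
        simp only [Matrix.mul_assoc]
      have e4 : (((K α)ᴴ * K α) * (Sᴴ * τ * S)).trace =
          (K α * Sᴴ * τ * S * (K α)ᴴ).trace := by
        rw [Matrix.mul_assoc, Matrix.trace_mul_comm]
        simp only [Matrix.mul_assoc]
      rw [e2, e3, e4, ← Matrix.trace_sub, ← Matrix.trace_sub, ← Matrix.trace_add]
      congr 1
      simp only [Matrix.conjTranspose_sub, Matrix.conjTranspose_mul,
        Matrix.conjTranspose_conjTranspose, Matrix.sub_mul, Matrix.mul_sub, Matrix.mul_assoc]
      abel
    simp only [h1, Finset.sum_add_distrib, Finset.sum_sub_distrib]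
    rw [← Matrix.trace_sum, ← Matrix.trace_sum, ← Matrix.trace_sum,
      ← Matrix.sum_mul, ← Matrix.sum_mul, ← Matrix.mul_sum, ← hSH, ← hS, hK, Matrix.one_mul,
      Matrix.mul_assoc]
    ring
  rw [hexp] at hpos
  have := (Complex.le_def.1 hpos).1
  simp only [Complex.zero_re, Complex.sub_re, Complex.re_sum] at this
  linarith

lemma sum_resolventForm_le {t : ℝ} (ht : 0 ≤ t) (K : ∀ α, Matrix (m α) n ℂ)
    (hK : ∑ α, (K α)ᴴ * K α = 1) {ρ σ : Matrix n n ℂ} (hρ : ρ.PosSemidef) (hσ : σ.PosSemidef)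
    (Y : ∀ α, Matrix (m α) (m α) ℂ) :
    ∑ α, resolventForm t (K α * ρ * (K α)ᴴ) (K α * σ * (K α)ᴴ) (Y α) ≤
      resolventForm t ρ σ (∑ α, (K α)ᴴ * Y α * K α) := by
  have hH : (∑ α, (K α)ᴴ * Y α * K α)ᴴ = ∑ α, (K α)ᴴ * (Y α)ᴴ * K α := by
    rw [Matrix.conjTranspose_sum]
    refine Finset.sum_congr rfl fun α _ => ?_
    simp only [Matrix.conjTranspose_mul, Matrix.conjTranspose_conjTranspose, Matrix.mul_assoc]
  have h1 : ((∑ α, (K α)ᴴ * Y α * K α)ᴴ * ρ).trace.re =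
      ∑ α, ((Y α)ᴴ * (K α * ρ * (K α)ᴴ)).trace.re := by
    rw [hH, Matrix.sum_mul, Matrix.trace_sum, Complex.re_sum]
    refine Finset.sum_congr rfl fun α _ => ?_
    simp only [Matrix.mul_assoc]
    rw [Matrix.trace_mul_comm]
    simp only [Matrix.mul_assoc]
  have h2 := trace_kadison_schwarz K hK hσ Y
  have h3 := trace_kadison_schwarz K hK hρ fun α => (Y α)ᴴ
  rw [← hH] at h3
  simp only [Matrix.conjTranspose_conjTranspose] at h3
  have h4 := mul_le_mul_of_nonneg_left h3 ht
  simp only [resolventForm, Finset.sum_sub_distrib, ← Finset.mul_sum]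
  rw [h1]
  linarith

end DataProcessing

section Coherence

variable {n b : Type} [Fintype n] [DecidableEq n] [Fintype b]

/-- The relative entropy of coherence `S(Δ(ρ)) - S(ρ)` of `ρ = Ψ Ψᴴ`. -/
def coherence (Ψ : Matrix n b ℂ) : ℝ :=
  entropy (dephase (Ψ * Ψᴴ)) - entropy (Ψ * Ψᴴ)

/-- The squared norms of the rows of a matrix. -/
def rowWeight {n : Type} (Ψ : Matrix n b ℂ) (x : n) : ℝ :=
  ∑ y, ‖Ψ x y‖ ^ 2

lemma rowWeight_nonneg {n : Type} (Ψ : Matrix n b ℂ) (x : n) : 0 ≤ rowWeight Ψ x :=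
  Finset.sum_nonneg fun _ _ => sq_nonneg _

lemma mul_star_eq_norm_sq (z : ℂ) : z * star z = ((‖z‖ ^ 2 : ℝ) : ℂ) := by
  rw [← Complex.normSq_eq_norm_sq, Complex.star_def, Complex.mul_conj]

lemma mul_conjTranspose_apply_self {n : Type} (Ψ : Matrix n b ℂ) (x : n) :
    (Ψ * Ψᴴ) x x = (rowWeight Ψ x : ℂ) := by
  simp only [Matrix.mul_apply, Matrix.conjTranspose_apply, mul_star_eq_norm_sq, rowWeight,
    Complex.ofReal_sum]

lemma dephase_mul_conjTranspose {n : Type} [DecidableEq n] (Ψ : Matrix n b ℂ) :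
    dephase (Ψ * Ψᴴ) = Matrix.diagonal fun x => (rowWeight Ψ x : ℂ) := by
  rw [dephase]
  congr 1
  funext x
  exact mul_conjTranspose_apply_self Ψ x

lemma conj_diagonal_apply_self {m : Type} (U : Matrix m n ℂ) (l : n → ℝ) (x : m) :
    (U * Matrix.diagonal (fun i => (l i : ℂ)) * Uᴴ) x x =
      ((∑ i, ‖U x i‖ ^ 2 * l i : ℝ) : ℂ) := by
  rw [Matrix.mul_apply, Complex.ofReal_sum]
  refine Finset.sum_congr rfl fun i _ => ?_
  rw [Matrix.mul_diagonal, Matrix.conjTranspose_apply, mul_right_comm, mul_star_eq_norm_sq,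
    Complex.ofReal_mul]

lemma sum_norm_sq_col {U : Matrix n n ℂ} (hU : Uᴴ * U = 1) (i : n) : ∑ j, ‖U j i‖ ^ 2 = 1 := by
  have h := congrFun (congrFun hU i) i
  simp only [Matrix.mul_apply, Matrix.conjTranspose_apply, Matrix.one_apply_eq] at h
  simp only [mul_comm (star _), mul_star_eq_norm_sq] at h
  exact_mod_cast h

lemma sum_norm_sq_mul_eq_rowWeight {Ψ : Matrix n b ℂ} {U : Matrix n n ℂ} {l : n → ℝ}
    (h : Ψ * Ψᴴ = U * Matrix.diagonal (fun i => (l i : ℂ)) * Uᴴ) (j : n) :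
    ∑ i, ‖U j i‖ ^ 2 * l i = rowWeight Ψ j := by
  have h1 := mul_conjTranspose_apply_self Ψ j
  rw [h, conj_diagonal_apply_self] at h1
  exact_mod_cast h1

lemma coherence_eq (Ψ : Matrix n b ℂ) {U : Matrix n n ℂ} (hU : Uᴴ * U = 1) (l : n → ℝ)
    (h : Ψ * Ψᴴ = U * Matrix.diagonal (fun i => (l i : ℂ)) * Uᴴ) :
    coherence Ψ = (∑ i, ∑ j, ‖U j i‖ ^ 2 * l i *
      (Real.log (l i) - Real.log (rowWeight Ψ j))) / Real.log 2 := by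
  have hrow : ∀ j, ∑ i, ‖U j i‖ ^ 2 * l i = rowWeight Ψ j := sum_norm_sq_mul_eq_rowWeight h
  rw [coherence, dephase_mul_conjTranspose, entropy_diagonal, h, entropy_conj_diagonal hU,
    ← sub_div]
  congr 1
  have e1 : ∑ i, ∑ j, ‖U j i‖ ^ 2 * l i * Real.log (l i) = ∑ i, l i * Real.log (l i) := by
    refine Finset.sum_congr rfl fun i _ => ?_
    rw [← Finset.sum_mul, ← Finset.sum_mul, sum_norm_sq_col hU, one_mul]
  have e2 : ∑ i, ∑ j, ‖U j i‖ ^ 2 * l i * Real.log (rowWeight Ψ j) =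
      ∑ j, rowWeight Ψ j * Real.log (rowWeight Ψ j) := by
    rw [Finset.sum_comm]
    refine Finset.sum_congr rfl fun j _ => ?_
    rw [← Finset.sum_mul, hrow]
  simp only [mul_sub, Finset.sum_sub_distrib, e1, e2, Real.negMulLog_eq_neg,
    Finset.sum_neg_distrib]
  ring

/-- A matrix maps the incoherent basis into multiples of incoherent basis vectors. -/
def ColumnsIncoherent {m n : Type} (K : Matrix m n ℂ) : Prop :=
  ∀ x z z', z ≠ z' → K z x * star (K z' x) = 0

lemma ColumnsIncoherent.conj_diagonal {m : Type} [DecidableEq m] {K : Matrix m n ℂ}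
    (hK : ColumnsIncoherent K) (μ : n → ℝ) :
    K * Matrix.diagonal (fun i => (μ i : ℂ)) * Kᴴ =
      Matrix.diagonal fun z => ((∑ x, ‖K z x‖ ^ 2 * μ x : ℝ) : ℂ) := by
  ext z z'
  by_cases hz : z = z'
  · subst hz
    rw [conj_diagonal_apply_self, Matrix.diagonal_apply_eq]
  · rw [Matrix.diagonal_apply_ne _ hz, Matrix.mul_apply]
    refine Finset.sum_eq_zero fun x _ => ?_
    rw [Matrix.mul_diagonal, Matrix.conjTranspose_apply, mul_right_comm, hK x z z' hz, zero_mul]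

lemma rowWeight_eq_zero_iff {n : Type} (Ψ : Matrix n b ℂ) (x : n) :
    rowWeight Ψ x = 0 ↔ ∀ y, Ψ x y = 0 := by
  simp [rowWeight, Finset.sum_eq_zero_iff_of_nonneg]

lemma sum_rowWeight {n : Type} [Fintype n] (Ψ : Matrix n b ℂ) :
    ((∑ x, rowWeight Ψ x : ℝ) : ℂ) = (Ψ * Ψᴴ).trace := by
  simp [Matrix.trace, mul_conjTranspose_apply_self]

/-- A nonselective Kraus set preserves the total weight. -/
lemma sum_sum_mul_eq {κ : Type} [Fintype κ] {m : κ → Type} [∀ α, Fintype (m α)]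
    (K : ∀ α, Matrix (m α) n ℂ) (hK : ∑ α, (K α)ᴴ * K α = 1) (μ : n → ℝ) :
    ∑ α, ∑ z, ∑ x, ‖K α z x‖ ^ 2 * μ x = ∑ x, μ x := by
  have h : ∀ x, ∑ α, ∑ z, ‖K α z x‖ ^ 2 = 1 := by
    intro x
    have h := congrFun (congrFun hK x) x
    rw [Matrix.sum_apply] at h
    simp only [Matrix.mul_apply, Matrix.conjTranspose_apply, Matrix.one_apply_eq] at h
    simp only [mul_comm (star _), mul_star_eq_norm_sq] at h
    exact_mod_cast h
  calc ∑ α, ∑ z, ∑ x, ‖K α z x‖ ^ 2 * μ x = ∑ x, ∑ α, ∑ z, ‖K α z x‖ ^ 2 * μ x := by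
        simp only [Finset.sum_comm (s := (Finset.univ : Finset n))]
    _ = _ := by simp only [← Finset.sum_mul, h, one_mul]

lemma trace_sum_kraus {κ : Type} [Fintype κ] {m : κ → Type} [∀ α, Fintype (m α)]
    (K : ∀ α, Matrix (m α) n ℂ) (hK : ∑ α, (K α)ᴴ * K α = 1) (ρ : Matrix n n ℂ) :
    ∑ α, (K α * ρ * (K α)ᴴ).trace = ρ.trace := by
  have : ∀ α, (K α * ρ * (K α)ᴴ).trace = ((K α)ᴴ * K α * ρ).trace := fun α => by
    rw [Matrix.trace_mul_comm, Matrix.mul_assoc]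
  simp only [this]
  rw [← Matrix.trace_sum, ← Matrix.sum_mul, hK, Matrix.one_mul]

/-- Strong monotonicity of the relative entropy of coherence under incoherent operations. -/
theorem sum_coherence_le {κ : Type} [Fintype κ] {m : κ → Type} [∀ α, Fintype (m α)]
    [∀ α, DecidableEq (m α)] (K : ∀ α, Matrix (m α) n ℂ) (hK : ∑ α, (K α)ᴴ * K α = 1)
    (hinc : ∀ α, ColumnsIncoherent (K α)) (Ψ : Matrix n b ℂ) :
    ∑ α, coherence (K α * Ψ) ≤ coherence Ψ := by
  obtain ⟨U, l, hU, -, hl, hρ⟩ := exists_spectral (Matrix.posSemidef_self_mul_conjTranspose Ψ)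
  choose V s hV _ hs hρ' using fun α =>
    exists_spectral (Matrix.posSemidef_self_mul_conjTranspose (K α * Ψ))
  have hconj : ∀ α, K α * (Ψ * Ψᴴ) * (K α)ᴴ = (K α * Ψ) * (K α * Ψ)ᴴ := fun α => by
    simp only [Matrix.conjTranspose_mul, Matrix.mul_assoc]
  set μ : n → ℝ := rowWeight Ψ with hμdef
  set ν : ∀ α, m α → ℝ := fun α z => ∑ x, ‖K α z x‖ ^ 2 * μ x with hνdef
  have hμ : ∀ x, 0 ≤ μ x := rowWeight_nonneg Ψ
  have hν : ∀ α z, 0 ≤ ν α z := fun α z =>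
    Finset.sum_nonneg fun x _ => mul_nonneg (sq_nonneg _) (hμ x)
  have hrow : ∀ j, ∑ i, ‖U j i‖ ^ 2 * l i = μ j := sum_norm_sq_mul_eq_rowWeight hρ
  have hrow' : ∀ α z, ∑ i, ‖V α z i‖ ^ 2 * s α i = rowWeight (K α * Ψ) z := fun α =>
    sum_norm_sq_mul_eq_rowWeight (hρ' α)
  have hμ0 : ∀ i j, μ j = 0 → ‖U j i‖ ^ 2 * l i = 0 := by
    intro i j h
    rw [← hrow j, Finset.sum_eq_zero_iff_of_nonneg fun i _ => mul_nonneg (sq_nonneg _) (hl i)] at h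
    exact h i (Finset.mem_univ _)
  have hνrow : ∀ α z, ν α z = 0 → rowWeight (K α * Ψ) z = 0 := by
    intro α z h
    rw [hνdef] at h
    rw [Finset.sum_eq_zero_iff_of_nonneg fun x _ => mul_nonneg (sq_nonneg _) (hμ x)] at h
    rw [rowWeight_eq_zero_iff]
    intro y
    rw [Matrix.mul_apply]
    refine Finset.sum_eq_zero fun x hx => ?_
    rcases mul_eq_zero.1 (h x hx) with h1 | h1
    · simp [norm_eq_zero.1 (pow_eq_zero_iff two_ne_zero |>.1 h1)]
    · rw [(rowWeight_eq_zero_iff Ψ x).1 h1 y, mul_zero]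
  have hν0 : ∀ α i z, ν α z = 0 → ‖V α z i‖ ^ 2 * s α i = 0 := by
    intro α i z h
    have h := hνrow α z h
    rw [← hrow' α z,
      Finset.sum_eq_zero_iff_of_nonneg fun i _ => mul_nonneg (sq_nonneg _) (hs α i)] at h
    exact h i (Finset.mem_univ _)
  have htot : ∑ α, ∑ z, rowWeight (K α * Ψ) z = ∑ x, μ x := by
    have h1 := trace_sum_kraus K hK (Ψ * Ψᴴ)
    simp only [hconj, ← sum_rowWeight] at h1
    exact_mod_cast h1
  have hdata := sum_mul_log_sub_log_nonneg
    (ι := (n × n) ⊕ (Σ α, m α × m α))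
    (Sum.elim (fun p => ‖U p.2 p.1‖ ^ 2) (fun p => -‖V p.1 p.2.2 p.2.1‖ ^ 2))
    (Sum.elim (fun p => l p.1) (fun p => s p.1 p.2.1))
    (Sum.elim (fun p => μ p.2) (fun p => ν p.1 p.2.2))
    (by rintro (p | p); exacts [hl _, hs _ _])
    (by rintro (p | p); exacts [hμ _, hν _ _])
    (by
      rintro (p | p) h
      · exact hμ0 _ _ h
      · simpa using hν0 _ p.2.1 _ h)
    (by
      simp only [Fintype.sum_sum_type, Sum.elim_inl, Sum.elim_inr, Fintype.sum_prod_type,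
        Fintype.sum_sigma, neg_mul, Finset.sum_neg_distrib]
      rw [Finset.sum_comm]
      simp only [hrow]
      have : ∀ α, ∑ i, ∑ z, ‖V α z i‖ ^ 2 * s α i = ∑ z, rowWeight (K α * Ψ) z := fun α => by
        rw [Finset.sum_comm]
        simp only [hrow']
      simp only [this, htot]
      ring)
    (by
      intro t ht
      simp only [Fintype.sum_sum_type, Sum.elim_inl, Sum.elim_inr, Fintype.sum_prod_type,
        Fintype.sum_sigma, neg_mul, neg_div, Finset.sum_neg_distrib]
      rw [← sub_eq_add_neg, sub_nonneg]
      choose Y hY using fun α => exists_resolventForm_eq t (hV α) (s α) (ν α)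
      have hσ : (Matrix.diagonal fun x => (μ x : ℂ)).PosSemidef :=
        Matrix.posSemidef_diagonal_iff.2 fun x => by exact_mod_cast hμ x
      have hY' : ∀ α, resolventForm t (K α * (Ψ * Ψᴴ) * (K α)ᴴ)
          (K α * Matrix.diagonal (fun x => (μ x : ℂ)) * (K α)ᴴ) (Y α) =
          ∑ i, ∑ z, ‖V α z i‖ ^ 2 * s α i ^ 2 / (ν α z + t * s α i) := fun α => by
        rw [hconj, hρ', (hinc α).conj_diagonal]
        exact hY α
      rw [← Finset.sum_congr rfl fun α _ => hY' α]
      refine (sum_resolventForm_le ht.le K hK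
        (Matrix.posSemidef_self_mul_conjTranspose Ψ) hσ Y).trans ?_
      rw [hρ]
      exact resolventForm_le t ht hU l μ hl hμ _)
  simp only [Fintype.sum_sum_type, Sum.elim_inl, Sum.elim_inr, Fintype.sum_prod_type,
    Fintype.sum_sigma, neg_mul, Finset.sum_neg_distrib] at hdata
  have hgibbs : 0 ≤ ∑ α, ∑ z, rowWeight (K α * Ψ) z *
      (Real.log (rowWeight (K α * Ψ) z) - Real.log (ν α z)) := by
    have h1 : ∑ α, ∑ z, (rowWeight (K α * Ψ) z - ν α z) = 0 := by
      simp only [Finset.sum_sub_distrib, htot, hνdef, sum_sum_mul_eq K hK, sub_self]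
    rw [← h1]
    exact Finset.sum_le_sum fun α _ => Finset.sum_le_sum fun z _ =>
      sub_le_mul_log_sub_log (rowWeight_nonneg _ _) (hν α z) (hνrow α z)
  have hsplit : ∀ α, ∑ i, ∑ z, ‖V α z i‖ ^ 2 * s α i *
      (Real.log (s α i) - Real.log (rowWeight (K α * Ψ) z)) =
      ∑ i, ∑ z, ‖V α z i‖ ^ 2 * s α i * (Real.log (s α i) - Real.log (ν α z)) -
      ∑ z, rowWeight (K α * Ψ) z *
        (Real.log (rowWeight (K α * Ψ) z) - Real.log (ν α z)) := by
    intro α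
    have h1 : ∑ z, rowWeight (K α * Ψ) z *
        (Real.log (rowWeight (K α * Ψ) z) - Real.log (ν α z)) =
        ∑ i, ∑ z, ‖V α z i‖ ^ 2 * s α i *
          (Real.log (rowWeight (K α * Ψ) z) - Real.log (ν α z)) := by
      rw [Finset.sum_comm]
      simp only [← Finset.sum_mul, hrow']
    rw [h1, ← Finset.sum_sub_distrib]
    refine Finset.sum_congr rfl fun i _ => ?_
    rw [← Finset.sum_sub_distrib]
    exact Finset.sum_congr rfl fun z _ => by ring
  rw [coherence_eq Ψ hU l hρ]
  simp only [fun α => coherence_eq (K α * Ψ) (hV α) (s α) (hρ' α)]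
  rw [← Finset.sum_div]
  refine div_le_div_of_nonneg_right ?_ (Real.log_nonneg one_le_two)
  simp only [hsplit, Finset.sum_sub_distrib (f := fun α => ∑ i, ∑ z, _)]
  linarith

lemma coherence_nonneg (Ψ : Matrix n b ℂ) : 0 ≤ coherence Ψ := by
  obtain ⟨U, l, hU, hU', hl, hρ⟩ := exists_spectral (Matrix.posSemidef_self_mul_conjTranspose Ψ)
  have hrow : ∀ j, ∑ i, ‖U j i‖ ^ 2 * l i = rowWeight Ψ j := sum_norm_sq_mul_eq_rowWeight hρ
  have hrow1 : ∀ j, ∑ i, ‖U j i‖ ^ 2 = 1 := fun j => by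
    simpa using sum_norm_sq_col (U := Uᴴ) (by simpa using hU') j
  rw [coherence_eq Ψ hU l hρ]
  refine div_nonneg ?_ (Real.log_nonneg one_le_two)
  have h0 : ∑ i, ∑ j, ‖U j i‖ ^ 2 * (l i - rowWeight Ψ j) = 0 := by
    rw [Finset.sum_comm]
    simp only [mul_sub, Finset.sum_sub_distrib, hrow, ← Finset.sum_mul, hrow1, one_mul, sub_self,
      Finset.sum_const_zero]
  rw [← h0]
  refine Finset.sum_le_sum fun i _ => Finset.sum_le_sum fun j _ => ?_
  by_cases hU0 : ‖U j i‖ ^ 2 = 0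
  · simp [hU0]
  rw [mul_assoc]
  refine mul_le_mul_of_nonneg_left (sub_le_mul_log_sub_log (hl i) (rowWeight_nonneg _ _) ?_)
    (sq_nonneg _)
  intro h
  rw [← hrow j, Finset.sum_eq_zero_iff_of_nonneg fun i _ => mul_nonneg (sq_nonneg _) (hl i)] at h
  exact (mul_eq_zero.1 (h i (Finset.mem_univ _))).resolve_left hU0

end Coherence

section PureStates

variable {a b : ℕ}

/-- The coefficient matrix of a bipartite vector. -/
def toMat (ψ : Fin a × Fin b → ℂ) : Matrix (Fin a) (Fin b) ℂ :=
  Matrix.of fun x y => ψ (x, y)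

/-- The extension of `pureCL` from unit vectors to all vectors that is homogeneous of degree one
in `proj ψ`. -/
def weightedCL (ψ : Fin a × Fin b → ℂ) : ℝ :=
  pureCL ψ - Real.negMulLog (∑ i, ‖ψ i‖ ^ 2) / Real.log 2

lemma weightedCL_of_isUnitVec {ψ : Fin a × Fin b → ℂ} (h : IsUnitVec ψ) :
    weightedCL ψ = pureCL ψ := by
  rw [weightedCL, show ∑ i, ‖ψ i‖ ^ 2 = 1 from h]
  simp

lemma proj_apply {n : Type} (ψ : n → ℂ) (i j : n) : proj ψ i j = ψ i * star (ψ j) := rfl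

lemma reduceA_proj (ψ : Fin a × Fin b → ℂ) :
    reduceA (proj ψ) = toMat ψ * (toMat ψ)ᴴ := by
  ext x x'
  simp [reduceA, proj_apply, toMat, Matrix.mul_apply]

lemma reduceB_proj (ψ : Fin a × Fin b → ℂ) :
    reduceB (proj ψ) = ((toMat ψ)ᴴ * toMat ψ)ᵀ := by
  ext y y'
  simp [reduceB, proj_apply, toMat, Matrix.mul_apply, mul_comm]

lemma reduceA_dephase (ρ : Matrix (Fin a × Fin b) (Fin a × Fin b) ℂ) :
    reduceA (dephase ρ) = dephase (reduceA ρ) := by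
  ext x x'
  by_cases h : x = x'
  · subst h
    simp [reduceA, dephase]
  · simp [reduceA, dephase, h]

lemma reduceB_dephase (ρ : Matrix (Fin a × Fin b) (Fin a × Fin b) ℂ) :
    reduceB (dephase ρ) = dephase (reduceB ρ) := by
  ext y y'
  by_cases h : y = y'
  · subst h
    simp [reduceB, dephase]
  · simp [reduceB, dephase, h]

lemma rowWeight_transpose_eq {m n : Type} [Fintype m] (M : Matrix m n ℂ) (y : n) :
    (rowWeight Mᵀ y : ℂ) = (Mᴴ * M) y y := by
  simp only [Matrix.mul_apply, Matrix.conjTranspose_apply, mul_comm (star _), mul_star_eq_norm_sq,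
    rowWeight, Complex.ofReal_sum, Matrix.transpose_apply]

lemma reduceB_dephase_proj (ψ : Fin a × Fin b → ℂ) :
    reduceB (dephase (proj ψ)) = Matrix.diagonal fun y => (rowWeight (toMat ψ)ᵀ y : ℂ) := by
  rw [reduceB_dephase, reduceB_proj, dephase]
  congr 1
  funext y
  rw [rowWeight_transpose_eq]
  rfl

lemma sum_norm_sq_eq (ψ : Fin a × Fin b → ℂ) :
    ∑ i, ‖ψ i‖ ^ 2 = ∑ y, rowWeight (toMat ψ)ᵀ y := by
  rw [Fintype.sum_prod_type, Finset.sum_comm]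
  rfl

lemma weightedCL_eq (ψ : Fin a × Fin b → ℂ) :
    weightedCL ψ = coherence (toMat ψ) + (∑ y, Real.negMulLog (rowWeight (toMat ψ)ᵀ y) -
      Real.negMulLog (∑ y, rowWeight (toMat ψ)ᵀ y)) / Real.log 2 := by
  rw [weightedCL, pureCL, entanglement, reduceB_dephase_proj, entropy_diagonal, reduceA_dephase,
    reduceA_proj, sum_norm_sq_eq, coherence]
  ring

lemma negMulLog_sum_le {β : Type*} [Fintype β] (q : β → ℝ) (hq : ∀ y, 0 ≤ q y) :
    Real.negMulLog (∑ y, q y) ≤ ∑ y, Real.negMulLog (q y) := by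
  have h : ∀ y, q y * Real.log (q y) ≤ q y * Real.log (∑ y, q y) := by
    intro y
    rcases (hq y).eq_or_lt with h | h
    · simp [← h]
    · exact mul_le_mul_of_nonneg_left (Real.log_le_log h
        (Finset.single_le_sum (fun y _ => hq y) (Finset.mem_univ y))) h.le
  have := Finset.sum_le_sum fun y (_ : y ∈ Finset.univ) => h y
  rw [← Finset.sum_mul] at this
  simp only [Real.negMulLog_eq_neg, Finset.sum_neg_distrib]
  linarith

lemma weightedCL_nonneg (ψ : Fin a × Fin b → ℂ) : 0 ≤ weightedCL ψ := by
  rw [weightedCL_eq]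
  refine add_nonneg (coherence_nonneg _) (div_nonneg ?_ (Real.log_nonneg one_le_two))
  exact sub_nonneg.2 (negMulLog_sum_le _ fun y => rowWeight_nonneg _ _)

lemma proj_smul {n : Type} (c : ℂ) (ψ : n → ℂ) :
    proj (c • ψ) = ((‖c‖ ^ 2 : ℝ) : ℂ) • proj ψ := by
  ext i j
  simp only [proj_apply, Pi.smul_apply, Matrix.smul_apply, smul_eq_mul, star_mul',
    ← mul_star_eq_norm_sq]
  ring

lemma coherence_smul {n β : Type} [Fintype n] [DecidableEq n] [Fintype β] (c : ℂ)
    (Ψ : Matrix n β ℂ) : coherence (c • Ψ) = ‖c‖ ^ 2 * coherence Ψ := by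
  have h1 : (c • Ψ) * (c • Ψ)ᴴ = ((‖c‖ ^ 2 : ℝ) : ℂ) • (Ψ * Ψᴴ) := by
    rw [Matrix.conjTranspose_smul, Matrix.smul_mul, Matrix.mul_smul, smul_smul,
      mul_star_eq_norm_sq]
  have h2 : dephase (((‖c‖ ^ 2 : ℝ) : ℂ) • (Ψ * Ψᴴ)) =
      ((‖c‖ ^ 2 : ℝ) : ℂ) • dephase (Ψ * Ψᴴ) := by
    rw [dephase, dephase, ← Matrix.diagonal_smul]
    rfl
  have h3 : (dephase (Ψ * Ψᴴ)).PosSemidef := by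
    rw [dephase_mul_conjTranspose]
    exact Matrix.posSemidef_diagonal_iff.2 fun x => by exact_mod_cast rowWeight_nonneg Ψ x
  have h4 : (dephase (Ψ * Ψᴴ)).trace = (Ψ * Ψᴴ).trace := by
    simp [dephase, Matrix.trace]
  rw [coherence, h1, h2, entropy_smul h3,
    entropy_smul (Matrix.posSemidef_self_mul_conjTranspose Ψ), h4, coherence]
  ring

lemma weightedCL_smul (c : ℂ) (ψ : Fin a × Fin b → ℂ) :
    weightedCL (c • ψ) = ‖c‖ ^ 2 * weightedCL ψ := by
  have h1 : toMat (c • ψ) = c • toMat ψ := rfl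
  have h2 : ∀ y, rowWeight (c • toMat ψ)ᵀ y = ‖c‖ ^ 2 * rowWeight (toMat ψ)ᵀ y := by
    intro y
    simp [rowWeight, Finset.mul_sum, mul_pow]
  rw [weightedCL_eq, weightedCL_eq, h1, coherence_smul]
  simp only [h2, ← Finset.mul_sum, Real.negMulLog_mul, Finset.sum_add_distrib, ← Finset.sum_mul]
  ring

lemma weightedCL_zero : weightedCL (0 : Fin a × Fin b → ℂ) = 0 := by
  simpa using weightedCL_smul 0 (0 : Fin a × Fin b → ℂ)

lemma entropy_reduceA_eq_entropy_reduceB (ψ : Fin a × Fin b → ℂ) :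
    entropy (reduceA (proj ψ)) = entropy (reduceB (proj ψ)) := by
  rw [reduceA_proj, reduceB_proj, entropy_transpose (Matrix.isHermitian_conjTranspose_mul_self _),
    entropy_mul_conjTranspose_comm]

lemma weightedCL_swap (ψ : Fin a × Fin b → ℂ) : weightedCL (ψ ∘ Prod.swap) = weightedCL ψ := by
  have h1 : reduceA (proj (ψ ∘ Prod.swap)) = reduceB (proj ψ) := rfl
  have h2 : reduceB (proj (ψ ∘ Prod.swap)) = reduceA (proj ψ) := rfl
  have h3 : ∑ i, ‖(ψ ∘ Prod.swap) i‖ ^ 2 = ∑ i, ‖ψ i‖ ^ 2 :=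
    Equiv.sum_comp (Equiv.prodComm (Fin b) (Fin a)) fun i => ‖ψ i‖ ^ 2
  rw [weightedCL, weightedCL, pureCL, pureCL, entanglement, entanglement, h3, reduceA_dephase,
    reduceB_dephase, reduceA_dephase, reduceB_dephase, h1, h2, entropy_reduceA_eq_entropy_reduceB]
  ring

lemma toMat_kronecker_one_mulVec {a' : ℕ} (K : Matrix (Fin a') (Fin a) ℂ)
    (ψ : Fin a × Fin b → ℂ) :
    toMat ((K ⊗ₖ (1 : Matrix (Fin b) (Fin b) ℂ)) *ᵥ ψ) = K * toMat ψ := by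
  ext z y
  simp [toMat, Matrix.mulVec, dotProduct, Fintype.sum_prod_type, Matrix.mul_apply,
    Matrix.one_apply]

lemma one_kronecker_mulVec_comp_swap {b' : ℕ} (K : Matrix (Fin b') (Fin b) ℂ)
    (ψ : Fin a × Fin b → ℂ) :
    ((1 : Matrix (Fin a) (Fin a) ℂ) ⊗ₖ K) *ᵥ ψ =
      ((K ⊗ₖ (1 : Matrix (Fin a) (Fin a) ℂ)) *ᵥ (ψ ∘ Prod.swap)) ∘ Prod.swap := by
  ext ⟨x, z⟩
  simp [Matrix.mulVec, dotProduct, Fintype.sum_prod_type, Matrix.one_apply]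

variable {κ : Type} [Fintype κ] {d : κ → ℕ}

/-- On average, `weightedCL` does not increase under incoherent operations of Alice. -/
lemma sum_weightedCL_alice_le (K : ∀ α, Matrix (Fin (d α)) (Fin a) ℂ)
    (hK : ∑ α, (K α)ᴴ * K α = 1) (hinc : ∀ α, ColumnsIncoherent (K α))
    (ψ : Fin a × Fin b → ℂ) :
    ∑ α, weightedCL ((K α ⊗ₖ (1 : Matrix (Fin b) (Fin b) ℂ)) *ᵥ ψ) ≤ weightedCL ψ := by
  have hcol : ∀ y, ∑ α, rowWeight (K α * toMat ψ)ᵀ y = rowWeight (toMat ψ)ᵀ y := by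
    intro y
    have h : ∑ α, (K α * toMat ψ)ᴴ * (K α * toMat ψ) = (toMat ψ)ᴴ * toMat ψ := by
      have h1 : ∀ α, (K α * toMat ψ)ᴴ * (K α * toMat ψ) =
          (toMat ψ)ᴴ * ((K α)ᴴ * K α) * toMat ψ := fun α => by
        simp only [Matrix.conjTranspose_mul, Matrix.mul_assoc]
      simp only [h1]
      rw [← Matrix.sum_mul, ← Matrix.mul_sum, hK, Matrix.mul_one]
    have h2 := congrFun (congrFun h y) y
    rw [Matrix.sum_apply] at h2
    simp only [← rowWeight_transpose_eq] at h2
    exact_mod_cast h2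
  have h1 := sum_coherence_le K hK hinc (toMat ψ)
  have h2 := sum_negMulLog_sub_le (fun α y => rowWeight (K α * toMat ψ)ᵀ y)
    fun α y => rowWeight_nonneg _ _
  simp only [hcol] at h2
  have h3 := div_le_div_of_nonneg_right h2 (Real.log_nonneg one_le_two)
  rw [Finset.sum_div] at h3
  simp only [weightedCL_eq, toMat_kronecker_one_mulVec]
  rw [Finset.sum_add_distrib]
  exact add_le_add h1 h3

/-- On average, `weightedCL` does not increase under incoherent operations of Bob. -/
lemma sum_weightedCL_bob_le (K : ∀ α, Matrix (Fin (d α)) (Fin b) ℂ)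
    (hK : ∑ α, (K α)ᴴ * K α = 1) (hinc : ∀ α, ColumnsIncoherent (K α))
    (ψ : Fin a × Fin b → ℂ) :
    ∑ α, weightedCL (((1 : Matrix (Fin a) (Fin a) ℂ) ⊗ₖ K α) *ᵥ ψ) ≤ weightedCL ψ := by
  simp only [one_kronecker_mulVec_comp_swap, weightedCL_swap]
  rw [← weightedCL_swap ψ]
  exact sum_weightedCL_alice_le K hK hinc (ψ ∘ Prod.swap)

lemma IsIncoherentOp.columnsIncoherent {m n : Type} [Fintype m] [Fintype n] [DecidableEq n]
    {M : Matrix m n ℂ} (hM : IsIncoherentOp M) : ColumnsIncoherent M := by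
  intro x z z' hz
  set ρ : Matrix n n ℂ := Matrix.diagonal (Pi.single x 1) with hρ
  have hpos : ρ.PosSemidef := Matrix.posSemidef_diagonal_iff.2 fun y => by
    by_cases h : y = x
    · subst h
      simp
    · simp [h]
  have hentry : (M * ρ * Mᴴ) z z' = M z x * star (M z' x) := by
    rw [Matrix.mul_apply]
    simp [hρ, Matrix.mul_diagonal, Pi.single_apply]
  by_cases ht : (M * ρ * Mᴴ).trace = 0
  · rw [(hpos.mul_mul_conjTranspose_same M).trace_eq_zero_iff] at ht
    rw [← hentry, ht]
    rfl
  · have h := (hM ρ ⟨⟨hpos, by simp [hρ, Matrix.trace_diagonal]⟩, Matrix.isDiag_diagonal _⟩ ht).2 hz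
    beta_reduce at h
    rw [Matrix.smul_apply, smul_eq_mul, hentry] at h
    exact (mul_eq_zero.1 h).resolve_left (inv_ne_zero ht)

lemma weightedCL_of_isEmpty [IsEmpty (Fin a × Fin b)] (ψ : Fin a × Fin b → ℂ) :
    weightedCL ψ = 0 := by
  rw [Subsingleton.elim ψ 0, weightedCL_zero]

lemma sum_weightedCL_le_of_isIncoherentOp_alice (K : ∀ α, Matrix (Fin (d α)) (Fin a) ℂ)
    (hK : ∑ α, (K α)ᴴ * K α = 1)
    (hinc : ∀ α, IsIncoherentOp (K α ⊗ₖ (1 : Matrix (Fin b) (Fin b) ℂ)))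
    (ψ : Fin a × Fin b → ℂ) :
    ∑ α, weightedCL ((K α ⊗ₖ (1 : Matrix (Fin b) (Fin b) ℂ)) *ᵥ ψ) ≤ weightedCL ψ := by
  rcases isEmpty_or_nonempty (Fin b) with hb | ⟨⟨y⟩⟩
  · simp [weightedCL_of_isEmpty]
  · refine sum_weightedCL_alice_le K hK (fun α x z z' hz => ?_) ψ
    simpa using (hinc α).columnsIncoherent (x, y) (z, y) (z', y) (by simpa using hz)

lemma sum_weightedCL_le_of_isIncoherentOp_bob (K : ∀ α, Matrix (Fin (d α)) (Fin b) ℂ)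
    (hK : ∑ α, (K α)ᴴ * K α = 1)
    (hinc : ∀ α, IsIncoherentOp ((1 : Matrix (Fin a) (Fin a) ℂ) ⊗ₖ K α))
    (ψ : Fin a × Fin b → ℂ) :
    ∑ α, weightedCL (((1 : Matrix (Fin a) (Fin a) ℂ) ⊗ₖ K α) *ᵥ ψ) ≤ weightedCL ψ := by
  rcases isEmpty_or_nonempty (Fin a) with ha | ⟨⟨x⟩⟩
  · simp [weightedCL_of_isEmpty]
  · refine sum_weightedCL_bob_le K hK (fun α y z z' hz => ?_) ψ
    simpa using (hinc α).columnsIncoherent (x, y) (x, z) (x, z') (by simpa using hz)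

end PureStates

section Decompositions

variable {a b : ℕ}

/-- `c` is the total `weightedCL` of some decomposition of `ρ` into unnormalized pure states. -/
def HasDecomp (ρ : Matrix (Fin a × Fin b) (Fin a × Fin b) ℂ) (c : ℝ) : Prop :=
  ∃ (N : ℕ) (v : Fin N → Fin a × Fin b → ℂ),
    ρ = ∑ k, proj (v k) ∧ c = ∑ k, weightedCL (v k)

lemma HasDecomp.of_fintype {ι : Type} [Fintype ι] (v : ι → Fin a × Fin b → ℂ) :
    HasDecomp (∑ k, proj (v k)) (∑ k, weightedCL (v k)) := by
  let e := (Fintype.equivFin ι).symm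
  exact ⟨Fintype.card ι, fun k => v (e k), (Equiv.sum_comp e fun k => proj (v k)).symm,
    (Equiv.sum_comp e fun k => weightedCL (v k)).symm⟩

lemma HasDecomp.sum {ι : Type} [Fintype ι] {ρ : ι → Matrix (Fin a × Fin b) (Fin a × Fin b) ℂ}
    {c : ι → ℝ} (h : ∀ i, HasDecomp (ρ i) (c i)) : HasDecomp (∑ i, ρ i) (∑ i, c i) := by
  choose N v hρ hc using h
  have := HasDecomp.of_fintype fun p : Σ i, Fin (N i) => v p.1 p.2
  simpa only [Fintype.sum_sigma, ← hρ, ← hc] using this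

lemma HasDecomp.zero : HasDecomp (0 : Matrix (Fin a × Fin b) (Fin a × Fin b) ℂ) 0 :=
  ⟨0, fun _ => 0, by simp, by simp⟩

lemma HasDecomp.add {ρ σ : Matrix (Fin a × Fin b) (Fin a × Fin b) ℂ} {c d : ℝ}
    (h : HasDecomp ρ c) (h' : HasDecomp σ d) : HasDecomp (ρ + σ) (c + d) := by
  have := HasDecomp.sum (ι := Fin 2) (ρ := ![ρ, σ]) (c := ![c, d])
    (by intro i; fin_cases i; exacts [h, h'])
  simpa using this

lemma HasDecomp.smul {ρ : Matrix (Fin a × Fin b) (Fin a × Fin b) ℂ} {c : ℝ}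
    (h : HasDecomp ρ c) {r : ℝ} (hr : 0 ≤ r) : HasDecomp ((r : ℂ) • ρ) (r * c) := by
  obtain ⟨N, v, rfl, rfl⟩ := h
  have hn : ‖((√r : ℝ) : ℂ)‖ ^ 2 = r := by
    rw [Complex.norm_real, Real.norm_eq_abs, sq_abs, Real.sq_sqrt hr]
  refine ⟨N, fun k => ((√r : ℝ) : ℂ) • v k, ?_, ?_⟩
  · simp only [proj_smul, hn, Finset.smul_sum]
  · simp only [weightedCL_smul, hn, Finset.mul_sum]

lemma HasDecomp.nonneg {ρ : Matrix (Fin a × Fin b) (Fin a × Fin b) ℂ} {c : ℝ}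
    (h : HasDecomp ρ c) : 0 ≤ c := by
  obtain ⟨N, v, -, rfl⟩ := h
  exact Finset.sum_nonneg fun k _ => weightedCL_nonneg _

lemma trace_proj {n : Type} [Fintype n] (ψ : n → ℂ) :
    (proj ψ).trace = ((∑ i, ‖ψ i‖ ^ 2 : ℝ) : ℂ) := by
  simp only [Matrix.trace, Matrix.diag_apply, proj_apply, mul_star_eq_norm_sq, Complex.ofReal_sum]

lemma HasDecomp.exists_trace_eq {ρ : Matrix (Fin a × Fin b) (Fin a × Fin b) ℂ} {c : ℝ}
    (h : HasDecomp ρ c) : ∃ r : ℝ, 0 ≤ r ∧ ρ.trace = r := by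
  obtain ⟨N, v, rfl, -⟩ := h
  refine ⟨∑ k, ∑ i, ‖v k i‖ ^ 2, by positivity, ?_⟩
  rw [Matrix.trace_sum, Complex.ofReal_sum]
  simp only [trace_proj]

lemma exists_hasDecomp {ρ : Matrix (Fin a × Fin b) (Fin a × Fin b) ℂ} (h : ρ.PosSemidef) :
    ∃ c, HasDecomp ρ c := by
  obtain ⟨U, l, -, -, hl, rfl⟩ := exists_spectral h
  have hρ : U * Matrix.diagonal (fun i => (l i : ℂ)) * Uᴴ =
      ∑ i, proj (((√(l i) : ℝ) : ℂ) • fun x => U x i) := by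
    ext x x'
    rw [Matrix.mul_apply, Matrix.sum_apply]
    refine Finset.sum_congr rfl fun i _ => ?_
    rw [proj_smul, Complex.norm_real, Real.norm_eq_abs, sq_abs, Real.sq_sqrt (hl i),
      Matrix.mul_diagonal, Matrix.conjTranspose_apply, Matrix.smul_apply, proj_apply, smul_eq_mul]
    ring
  rw [hρ]
  exact ⟨_, HasDecomp.of_fintype _⟩

/-- The ensemble averages of a state are the totals of its unnormalized decompositions. -/
lemma mem_ensembleAverages_iff {ρ : Matrix (Fin a × Fin b) (Fin a × Fin b) ℂ}
    (hρ : ρ.trace = 1) (c : ℝ) : c ∈ ensembleAverages ρ ↔ HasDecomp ρ c := by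
  constructor
  · rintro ⟨n, p, φ, ⟨hp, -, hφ, rfl⟩, rfl⟩
    refine HasDecomp.sum fun k => HasDecomp.smul ⟨1, fun _ => φ k, ?_, ?_⟩ (hp k)
    · simp
    · simp [weightedCL_of_isUnitVec (hφ k)]
  · rintro ⟨N, v, rfl, rfl⟩
    have hne : Nonempty (Fin a × Fin b) := by
      by_contra hempty
      rw [not_nonempty_iff] at hempty
      simp [Matrix.trace] at hρ
    obtain ⟨i₀⟩ := hne
    have hkey : ∀ k, ∃ φ : Fin a × Fin b → ℂ, IsUnitVec φ ∧
        proj (v k) = ((∑ i, ‖v k i‖ ^ 2 : ℝ) : ℂ) • proj φ ∧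
        weightedCL (v k) = (∑ i, ‖v k i‖ ^ 2) * pureCL φ := by
      intro k
      set r : ℝ := ∑ i, ‖v k i‖ ^ 2 with hr
      have hr0 : 0 ≤ r := by positivity
      have hex : ∃ φ : Fin a × Fin b → ℂ, IsUnitVec φ ∧ v k = ((√r : ℝ) : ℂ) • φ := by
        rcases hr0.eq_or_lt with h | h
        · refine ⟨Pi.single i₀ 1, ?_, ?_⟩
          · rw [IsUnitVec, Finset.sum_eq_single i₀]
            · simp
            · intro i _ hi
              simp [hi]
            · simp
          · have h0 : ∀ i, ‖v k i‖ ^ 2 = 0 := fun i =>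
              (Finset.sum_eq_zero_iff_of_nonneg fun i _ => sq_nonneg _).1 h.symm i
                (Finset.mem_univ i)
            rw [← h]
            ext i
            simpa using h0 i
        · have hs : √r ≠ 0 := (Real.sqrt_pos.2 h).ne'
          refine ⟨(((√r)⁻¹ : ℝ) : ℂ) • v k, ?_, ?_⟩
          · simp only [IsUnitVec, Pi.smul_apply, norm_smul, mul_pow, ← Finset.mul_sum, ← hr,
              Complex.norm_real, Real.norm_eq_abs, sq_abs, inv_pow, Real.sq_sqrt hr0]
            exact inv_mul_cancel₀ h.ne'
          · rw [smul_smul, ← Complex.ofReal_mul, mul_inv_cancel₀ hs]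
            simp
      obtain ⟨φ, hφ, hv⟩ := hex
      have hn : ‖((√r : ℝ) : ℂ)‖ ^ 2 = r := by
        rw [Complex.norm_real, Real.norm_eq_abs, sq_abs, Real.sq_sqrt hr0]
      refine ⟨φ, hφ, ?_, ?_⟩
      · rw [hv, proj_smul, hn]
      · rw [hv, weightedCL_smul, hn, weightedCL_of_isUnitVec hφ]
    choose φ hφ h1 h2 using hkey
    refine ⟨N, fun k => ∑ i, ‖v k i‖ ^ 2, φ, ⟨fun k => by positivity, ?_, hφ, ?_⟩, ?_⟩
    · rw [Matrix.trace_sum] at hρ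
      simp only [trace_proj] at hρ
      exact_mod_cast hρ
    · simp only [← h1]
    · simp only [← h2]

lemma bddBelow_ensembleAverages {ρ : Matrix (Fin a × Fin b) (Fin a × Fin b) ℂ}
    (hρ : ρ.trace = 1) : BddBelow (ensembleAverages ρ) :=
  ⟨0, fun c hc => ((mem_ensembleAverages_iff hρ c).1 hc).nonneg⟩

lemma nonempty_ensembleAverages {ρ : Matrix (Fin a × Fin b) (Fin a × Fin b) ℂ}
    (hρ : IsState ρ) : (ensembleAverages ρ).Nonempty := by
  obtain ⟨c, hc⟩ := exists_hasDecomp hρ.1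
  exact ⟨c, (mem_ensembleAverages_iff hρ.2 c).2 hc⟩

lemma CL_le_of_hasDecomp {ρ : Matrix (Fin a × Fin b) (Fin a × Fin b) ℂ} (hρ : ρ.trace = 1)
    {c : ℝ} (h : HasDecomp ρ c) : CL ρ ≤ c :=
  csInf_le (bddBelow_ensembleAverages hρ) ((mem_ensembleAverages_iff hρ c).2 h)

lemma le_CL {ρ : Matrix (Fin a × Fin b) (Fin a × Fin b) ℂ} (hρ : IsState ρ) {r : ℝ}
    (h : ∀ c, HasDecomp ρ c → r ≤ c) : r ≤ CL ρ :=
  le_csInf (nonempty_ensembleAverages hρ) fun c hc =>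
    h c ((mem_ensembleAverages_iff hρ.2 c).1 hc)

lemma exists_hasDecomp_lt {ρ : Matrix (Fin a × Fin b) (Fin a × Fin b) ℂ} (hρ : IsState ρ)
    {r : ℝ} (h : CL ρ < r) : ∃ c < r, HasDecomp ρ c := by
  obtain ⟨c, hc, hcr⟩ := exists_lt_of_csInf_lt (nonempty_ensembleAverages hρ) h
  exact ⟨c, hcr, (mem_ensembleAverages_iff hρ.2 c).1 hc⟩

lemma CL_convex (ρ σ : Matrix (Fin a × Fin b) (Fin a × Fin b) ℂ) (t : ℝ)
    (hρ : IsState ρ) (hσ : IsState σ) (ht : 0 ≤ t) (ht' : t ≤ 1) :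
    CL ((t : ℂ) • ρ + ((1 - t : ℝ) : ℂ) • σ) ≤ t * CL ρ + (1 - t) * CL σ := by
  refine le_of_forall_pos_lt_add fun ε hε => ?_
  obtain ⟨c, hc, h1⟩ := exists_hasDecomp_lt hρ (lt_add_of_pos_right (CL ρ) (half_pos hε))
  obtain ⟨d, hd, h2⟩ := exists_hasDecomp_lt hσ (lt_add_of_pos_right (CL σ) (half_pos hε))
  have htr : ((t : ℂ) • ρ + ((1 - t : ℝ) : ℂ) • σ).trace = 1 := by
    simp [Matrix.trace_add, Matrix.trace_smul, hρ.2, hσ.2]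
  have h := CL_le_of_hasDecomp htr ((h1.smul ht).add (h2.smul (sub_nonneg.2 ht')))
  have e1 := mul_le_mul_of_nonneg_left hc.le ht
  have e2 := mul_le_mul_of_nonneg_left hd.le (sub_nonneg.2 ht')
  nlinarith

/-- Every vector in a decomposition of a pure state is a multiple of that state. -/
lemma eq_smul_of_proj_eq_sum {n : Type} [Fintype n] {ι : Type} [Fintype ι] {ψ : n → ℂ}
    (hψ : IsUnitVec ψ) {v : ι → n → ℂ} (h : proj ψ = ∑ k, proj (v k)) (k : ι) :
    ∃ c : ℂ, v k = c • ψ := by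
  have hform : ∀ (w u : n → ℂ), star w ⬝ᵥ (proj u *ᵥ w) =
      ((‖star u ⬝ᵥ w‖ ^ 2 : ℝ) : ℂ) := by
    intro w u
    rw [proj, Matrix.vecMulVec_mulVec, dotProduct_smul, ← mul_star_eq_norm_sq,
      Matrix.star_dotProduct]
    simp [dotProduct_comm, mul_comm]
  have hψ1 : star ψ ⬝ᵥ ψ = 1 := by
    simp only [dotProduct, Pi.star_apply, mul_comm (star _), mul_star_eq_norm_sq]
    exact_mod_cast hψ
  set c := star ψ ⬝ᵥ v k with hc
  set w := v k - c • ψ with hw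
  have hψw : star ψ ⬝ᵥ w = 0 := by
    rw [hw, dotProduct_sub, dotProduct_smul, hψ1, ← hc]
    simp
  have h1 := congrArg (fun M => star w ⬝ᵥ (M *ᵥ w)) h
  simp only [Matrix.sum_mulVec, dotProduct_sum, hform, hψw] at h1
  have h2 : ∑ k, ‖star (v k) ⬝ᵥ w‖ ^ 2 = 0 := by
    have h3 : ((∑ k, ‖star (v k) ⬝ᵥ w‖ ^ 2 : ℝ) : ℂ) = 0 := by
      rw [Complex.ofReal_sum, ← h1]
      simp
    exact_mod_cast h3
  have h4 : star (v k) ⬝ᵥ w = 0 := by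
    have := (Finset.sum_eq_zero_iff_of_nonneg fun k _ => sq_nonneg _).1 h2 k (Finset.mem_univ k)
    simpa using this
  have h5 : star w ⬝ᵥ w = 0 := by
    have : star w ⬝ᵥ w = star (v k) ⬝ᵥ w - star c • (star ψ ⬝ᵥ w) := by
      nth_rewrite 1 [hw]
      rw [star_sub, star_smul, sub_dotProduct, smul_dotProduct]
    rw [this, h4, hψw]
    simp
  exact ⟨c, sub_eq_zero.1 (dotProduct_star_self_eq_zero.1 h5)⟩

lemma proj_posSemidef {n : Type} [Fintype n] (ψ : n → ℂ) : (proj ψ).PosSemidef :=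
  Matrix.posSemidef_vecMulVec_self_star ψ

lemma isState_proj {n : Type} [Fintype n] {ψ : n → ℂ} (hψ : IsUnitVec ψ) : IsState (proj ψ) :=
  ⟨proj_posSemidef ψ, by rw [trace_proj, show ∑ i, ‖ψ i‖ ^ 2 = 1 from hψ, Complex.ofReal_one]⟩

lemma CL_proj {ψ : Fin a × Fin b → ℂ} (hψ : IsUnitVec ψ) : CL (proj ψ) = pureCL ψ := by
  have hst := isState_proj hψ
  refine le_antisymm (CL_le_of_hasDecomp hst.2
    ⟨1, fun _ => ψ, by simp, by simp [weightedCL_of_isUnitVec hψ]⟩) (le_CL hst ?_)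
  rintro c ⟨N, v, hv, rfl⟩
  choose d hd using eq_smul_of_proj_eq_sum hψ hv
  have htr := hst.2
  rw [hv, Matrix.trace_sum] at htr
  have hsum : ∑ k, ‖d k‖ ^ 2 = 1 := by
    have h1 : ∀ k, (proj (v k)).trace = ((‖d k‖ ^ 2 : ℝ) : ℂ) := fun k => by
      rw [hd k, proj_smul, Matrix.trace_smul, hst.2, smul_eq_mul, mul_one]
    simp only [h1] at htr
    exact_mod_cast htr
  have h2 : ∀ k, weightedCL (v k) = ‖d k‖ ^ 2 * pureCL ψ := fun k => by
    rw [hd k, weightedCL_smul, weightedCL_of_isUnitVec hψ]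
  simp only [h2]
  rw [← Finset.sum_mul, hsum, one_mul]

end Decompositions

section Protocols

lemma mul_proj_mul_conjTranspose {m n : Type} [Fintype n] (M : Matrix m n ℂ) (ψ : n → ℂ) :
    M * proj ψ * Mᴴ = proj (M *ᵥ ψ) := by
  rw [proj, proj, Matrix.mul_vecMulVec, Matrix.vecMulVec_mul, Matrix.star_mulVec]

lemma HasDecomp.exists_kraus {a b : ℕ} {ι : Type} [Fintype ι] {mult dA dB : ι → ℕ}
    (M : ∀ i, Fin (mult i) → Matrix (Fin (dA i) × Fin (dB i)) (Fin a × Fin b) ℂ)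
    (hM : ∀ ψ, ∑ i, ∑ j, weightedCL (M i j *ᵥ ψ) ≤ weightedCL ψ)
    {ρ : Matrix (Fin a × Fin b) (Fin a × Fin b) ℂ} {c : ℝ} (h : HasDecomp ρ c) :
    ∃ c' : ι → ℝ, ∑ i, c' i ≤ c ∧ ∀ i, HasDecomp (∑ j, M i j * ρ * (M i j)ᴴ) (c' i) := by
  obtain ⟨N, v, rfl, rfl⟩ := h
  refine ⟨fun i => ∑ j, ∑ k, weightedCL (M i j *ᵥ v k), ?_, fun i => ?_⟩
  · calc ∑ i, ∑ j, ∑ k, weightedCL (M i j *ᵥ v k)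
        = ∑ k, ∑ i, ∑ j, weightedCL (M i j *ᵥ v k) := by
          rw [Finset.sum_comm]
          refine Finset.sum_congr rfl fun i _ => ?_
          rw [Finset.sum_comm]
      _ ≤ _ := Finset.sum_le_sum fun k _ => hM (v k)
  · refine HasDecomp.sum fun j => ?_
    rw [Matrix.mul_sum, Matrix.sum_mul]
    simp only [mul_proj_mul_conjTranspose]
    exact HasDecomp.of_fintype _

variable {n : ℕ} {dA dB : Fin n → ℕ}

lemma Instrument.complete_sigma {d : ℕ} (I : Instrument d) :
    ∑ p : Σ i, Fin (I.mult i), (I.kraus p.1 p.2)ᴴ * I.kraus p.1 p.2 = 1 := by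
  rw [Fintype.sum_sigma]
  exact I.complete

/-- A protocol turns each decomposition of `ρ` into decompositions of its unnormalized outcomes
whose totals add up to at most the total of the original one. -/
lemma HasDecomp.run {a b : ℕ} (P : Protocol dA dB a b) :
    ∀ {ρ : Matrix (Fin a × Fin b) (Fin a × Fin b) ℂ} {c : ℝ}, HasDecomp ρ c →
    ∃ c' : Fin n → ℝ, ∑ k, c' k ≤ c ∧ ∀ k, HasDecomp (P.run ρ k) (c' k) := by
  induction P with
  | done k₀ =>
    intro ρ c h
    refine ⟨Pi.single k₀ c, by simp, fun k => ?_⟩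
    rw [Protocol.run]
    by_cases hk : k = k₀
    · subst hk
      simpa using h
    · simpa [hk] using HasDecomp.zero
  | @alice a b I hI next ih =>
    intro ρ c h
    obtain ⟨c₁, hc₁, h₁⟩ := HasDecomp.exists_kraus
      (fun i j => I.kraus i j ⊗ₖ (1 : Matrix (Fin b) (Fin b) ℂ))
      (fun ψ => by
        have := sum_weightedCL_le_of_isIncoherentOp_alice (d := fun p => I.out p.1)
          (fun p : Σ i, Fin (I.mult i) => I.kraus p.1 p.2) I.complete_sigma
          (fun p => hI p.1 p.2) ψ
        rwa [Fintype.sum_sigma] at this) h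
    choose c₂ hc₂ h₂ using fun i => ih i (h₁ i)
    refine ⟨fun k => ∑ i, c₂ i k, ?_, fun k => ?_⟩
    · rw [Finset.sum_comm]
      exact (Finset.sum_le_sum fun i _ => hc₂ i).trans hc₁
    · rw [Protocol.run]
      exact HasDecomp.sum fun i => h₂ i k
  | @bob a b I hI next ih =>
    intro ρ c h
    obtain ⟨c₁, hc₁, h₁⟩ := HasDecomp.exists_kraus
      (fun i j => (1 : Matrix (Fin a) (Fin a) ℂ) ⊗ₖ I.kraus i j)
      (fun ψ => by
        have := sum_weightedCL_le_of_isIncoherentOp_bob (d := fun p => I.out p.1)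
          (fun p : Σ i, Fin (I.mult i) => I.kraus p.1 p.2) I.complete_sigma
          (fun p => hI p.1 p.2) ψ
        rwa [Fintype.sum_sigma] at this) h
    choose c₂ hc₂ h₂ using fun i => ih i (h₁ i)
    refine ⟨fun k => ∑ i, c₂ i k, ?_, fun k => ?_⟩
    · rw [Finset.sum_comm]
      exact (Finset.sum_le_sum fun i _ => hc₂ i).trans hc₁
    · rw [Protocol.run]
      exact HasDecomp.sum fun i => h₂ i k

lemma Instrument.complete_kronecker_one {d : ℕ} (I : Instrument d) (b : ℕ) :
    ∑ p : Σ i, Fin (I.mult i), (I.kraus p.1 p.2 ⊗ₖ (1 : Matrix (Fin b) (Fin b) ℂ))ᴴ *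
      (I.kraus p.1 p.2 ⊗ₖ (1 : Matrix (Fin b) (Fin b) ℂ)) = 1 := by
  rw [← Matrix.one_kronecker_one, ← I.complete_sigma]
  ext ⟨x, y⟩ ⟨x', y'⟩
  simp only [Matrix.conjTranspose_kronecker, ← Matrix.mul_kronecker_mul, Matrix.sum_apply,
    Matrix.kronecker_apply, Matrix.conjTranspose_one, Matrix.one_mul, Finset.sum_mul]

lemma Instrument.complete_one_kronecker {d : ℕ} (I : Instrument d) (a : ℕ) :
    ∑ p : Σ i, Fin (I.mult i), ((1 : Matrix (Fin a) (Fin a) ℂ) ⊗ₖ I.kraus p.1 p.2)ᴴ *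
      ((1 : Matrix (Fin a) (Fin a) ℂ) ⊗ₖ I.kraus p.1 p.2) = 1 := by
  rw [← Matrix.one_kronecker_one, ← I.complete_sigma]
  ext ⟨x, y⟩ ⟨x', y'⟩
  simp only [Matrix.conjTranspose_kronecker, ← Matrix.mul_kronecker_mul, Matrix.sum_apply,
    Matrix.kronecker_apply, Matrix.conjTranspose_one, Matrix.one_mul, Finset.mul_sum]

lemma Protocol.sum_trace_run {a b : ℕ} (P : Protocol dA dB a b) :
    ∀ ρ : Matrix (Fin a × Fin b) (Fin a × Fin b) ℂ, ∑ k, (P.run ρ k).trace = ρ.trace := by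
  induction P with
  | done k₀ =>
    intro ρ
    rw [Finset.sum_eq_single k₀]
    · simp [Protocol.run]
    · intro k _ hk
      simp [Protocol.run, hk]
    · simp
  | @alice a b I hI next ih =>
    intro ρ
    simp only [Protocol.run, Matrix.trace_sum]
    rw [Finset.sum_comm]
    simp only [ih, Matrix.trace_sum]
    have := trace_sum_kraus _ (I.complete_kronecker_one b) ρ
    rwa [Fintype.sum_sigma] at this
  | @bob a b I hI next ih =>
    intro ρ
    simp only [Protocol.run, Matrix.trace_sum]
    rw [Finset.sum_comm]
    simp only [ih, Matrix.trace_sum]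
    have := trace_sum_kraus _ (I.complete_one_kronecker a) ρ
    rwa [Fintype.sum_sigma] at this

lemma sum_prob_mul_CL_post_le {a b : ℕ} (P : Protocol dA dB a b)
    (ρ : Matrix (Fin a × Fin b) (Fin a × Fin b) ℂ) (hρ : IsState ρ) :
    ∑ k, P.prob ρ k * CL (P.post ρ k) ≤ CL ρ := by
  refine le_CL hρ fun c hc => ?_
  obtain ⟨c', hc', h⟩ := hc.run P
  refine (Finset.sum_le_sum fun k _ => ?_).trans hc'
  obtain ⟨r, hr, htr⟩ := (h k).exists_trace_eq
  have hp : P.prob ρ k = r := by rw [Protocol.prob, htr, Complex.ofReal_re]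
  rcases hr.eq_or_lt with h0 | h0
  · rw [hp, ← h0, zero_mul]
    exact (h k).nonneg
  have hpost : P.post ρ k = ((r⁻¹ : ℝ) : ℂ) • P.run ρ k := by
    rw [Protocol.post, hp, Complex.ofReal_inv]
  have htr1 : (P.post ρ k).trace = 1 := by
    rw [hpost, Matrix.trace_smul, htr, smul_eq_mul, ← Complex.ofReal_mul, inv_mul_cancel₀ h0.ne',
      Complex.ofReal_one]
  have h1 : CL (P.post ρ k) ≤ r⁻¹ * c' k :=
    CL_le_of_hasDecomp htr1 (hpost ▸ (h k).smul (inv_nonneg.2 hr))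
  calc P.prob ρ k * CL (P.post ρ k) ≤ r * (r⁻¹ * c' k) := by
        rw [hp]
        exact mul_le_mul_of_nonneg_left h1 hr
    _ = c' k := mul_inv_cancel_left₀ h0.ne' _

lemma CL_run_le {a b a' b' : ℕ}
    (P : Protocol (fun _ : Fin 1 => a') (fun _ : Fin 1 => b') a b)
    (ρ : Matrix (Fin a × Fin b) (Fin a × Fin b) ℂ) (hρ : IsState ρ) :
    CL (P.run ρ 0) ≤ CL ρ := by
  have htr := P.sum_trace_run ρ
  rw [Fin.sum_univ_one, hρ.2] at htr
  have hp : P.prob ρ 0 = 1 := by rw [Protocol.prob, htr, Complex.one_re]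
  have h := sum_prob_mul_CL_post_le P ρ hρ
  rw [Fin.sum_univ_one, Protocol.post, hp] at h
  simpa using h

end Protocols

end LIOCC

end

theorem theorem4 :
    LIOCC.IsMonotone (fun {a b : ℕ} => LIOCC.CL (a := a) (b := b)) ∧
    (∀ {a b : ℕ} (ρ : Matrix (Fin a × Fin b) (Fin a × Fin b) ℂ), LIOCC.IsState ρ →
      IsGLB (LIOCC.ensembleAverages ρ) (LIOCC.CL ρ)) ∧
    (∀ {a b : ℕ} (ψ : Fin a × Fin b → ℂ), LIOCC.IsUnitVec ψ →
      LIOCC.CL (LIOCC.proj ψ) = LIOCC.pureCL ψ) := by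
  refine ⟨⟨fun ρ hρ => LIOCC.le_CL hρ fun c hc => hc.nonneg, LIOCC.CL_convex,
    LIOCC.sum_prob_mul_CL_post_le, LIOCC.CL_run_le⟩, fun ρ hρ => ?_, fun ψ hψ => LIOCC.CL_proj hψ⟩
  exact isGLB_csInf (LIOCC.nonempty_ensembleAverages hρ) (LIOCC.bddBelow_ensembleAverages hρ.2)
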